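/- Let $f:\mathbb R^d\to\mathbb R$ be differentiable with $f^{\inf}:=\inf f>-\infty$, let $x^0\in\mathbb R^d$ and $\Delta:=f(x^0)-f^{\inf}$. A stochastic first-order oracle (SFO) returns $\nabla f(x;\xi)\in\mathbb R^d$ at a queried point $x$, where $\xi$ has a fixed law and $(x,\xi)\mapsto\nabla f(x;\xi)$ is measurable. Assume that it is unbiased with bounded variance: $\mathbb E_\xi[\nabla f(x;\xi)]=\nabla f(x)$ and $\mathbb E_\xi\|\nabla f(x;\xi)-\nabla f(x)\|^2\le G^2$ for all $x$, with $G\ge 0$. NSTORM with one-sample initialization and horizon $K\ge0$: let $\xi^0,\xi^1,\dots$ be i.i.d. samples, $v^0=\nabla f(x^0;\xi^0)$, and for $k=0,\dots,K$ $$x^{k+1}=x^k-\gamma\frac{v^k}{\|v^k\|},\qquad v^{k+1}=\nabla f(x^{k+1};\xi^{k+1})+(1-\eta)\bigl(v^k-\nabla f(x^k;\xi^{k+1})\bigr),$$ with $v^k/\|v^k\|:=0$ if $v^k=0$. The output $\widehat x$ is uniform on $\{x^0,\dots,x^K\}$, its index being independent of the samples. Put $T:=K+1$, $b_0:=\mathbb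 E\|v^0-\nabla f(x^0)\|$, and choose $\eta=\eta_0T^{-2/3}$, $\gamma=\gamma_0T^{-2/3}$ with $\eta_0\in(0,1]$, $\gamma_0>0$. Smoothness conditions: - Mean-square smoothness with constant $L>0$: $\mathbb E_\xi\|\nabla f(y;\xi)-\nabla f(x;\xi)\|^2\le L^2\|y-x\|^2$ for all $x,y$. - Expected $\alpha$-symmetric generalized smoothness, $\alpha\in(0,1]$, with constants $L_0,L_1>0$: for almost every $\xi$ the map $x\mapsto\nabla f(x;\xi)$ is continuous, and for all $x,y$, with $x_\theta:=\theta y+(1-\theta)x$, $$\mathbb E_\xi\|\nabla f(y;\xi)-\nabla f(x;\xi)\|^2\le\|y-x\|^2\,\mathbb E_\xi\Bigl[\bigl(L_0+L_1\max_{\theta\in[0,1]}\|\nabla f(x_\theta;\xi)\|^\alpha\bigr)^2\Bigr]<\infty .$$ Then in each of the cases below $b_0\le G$ and, for every $K\ge 0$, $\mathbb E\|\nabla f(\widehat x)\|$ is finite and satisfies the stated bound. (i) Under mean-square smoothness, $$\mathbb E\|\nabla f(\widehat x)\|\le\Bigl(\frac{\Delta}{\gamma_0}+\frac{2b_0}{\eta_0}+\frac{2L\gamma_0}{\sqrt{\eta_0}}+2\sqrt{\eta_0}\,G\Bigr)T^{-1/3}+\frac{L\gamma_0}{2}T^{-2/3}.$$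 (ii) Under expected $\alpha$-symmetric generalized smoothness with $\alpha\in(0,1)$, put $p:=\frac{\alpha}{1-\alpha}$, $c_\alpha:=(1-\alpha)\alpha^{p}$, $K_0:=2^{\frac{2-\alpha}{1-\alpha}}L_0$, $K_1:=2^{\frac{2-\alpha}{1-\alpha}}L_1$, $K_2:=(5L_1)^{\frac1{1-\alpha}}$, $L_\alpha:=2^{\alpha/2}K_1$. If $\lambda_0>0$, $L_\alpha\lambda_0\gamma_0\le1$ and $8L_\alpha\lambda_0\gamma_0/\eta_0\le1$, then $$\begin{aligned}\mathbb E\|\nabla f(\widehat x)\|\le{}&\Bigl[\frac{4\Delta}{\gamma_0}+\frac{8b_0}{\eta_0}+\frac{8\gamma_0}{\sqrt{\eta_0}}\bigl(K_0+c_\alpha L_\alpha\lambda_0^{-p}+L_\alpha G^\alpha\bigr)+8\sqrt{\eta_0}\,G\Bigr]T^{-1/3}\\&+\frac{8K_2\gamma_0^{p+1}}{\sqrt{\eta_0}}T^{-(1+2p)/3}+2\gamma_0\bigl(K_0+c_\alpha L_\alpha\lambda_0^{-p}\bigr)T^{-2/3}\\&+4K_2\gamma_0^{p+1}T^{-2(p+1)/3}+2L_\alpha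 G^\alpha\gamma_0T^{-2/3}.\end{aligned}$$ (iii) Under expected $1$-symmetric generalized smoothness, if $\gamma_0\le\frac1{4\sqrt2L_1}$ and $16\sqrt{2e^{3/4}}\,L_1\gamma_0/\eta_0\le1$, then $$\begin{aligned}\mathbb E\|\nabla f(\widehat x)\|\le{}&\Bigl[\frac{4\Delta}{\gamma_0}+\frac{8b_0}{\eta_0}+\frac{8\sqrt{2e^{3/4}}\,\gamma_0}{\sqrt{\eta_0}}(L_0+2L_1G)+8\sqrt{\eta_0}\,G\Bigr]T^{-1/3}\\&+\bigl(4\sqrt2L_0\gamma_0+8\sqrt2L_1G\gamma_0\bigr)T^{-2/3}.\end{aligned}$$ Consequently, in each case $\mathbb E\|\nabla f(\widehat x)\|=\mathcal O(T^{-1/3})$ and the SFO complexity is $\mathcal O(\varepsilon^{-3})$. That is, there are a constant $C$ and horizons $N(\varepsilon)$, depending only on an upper bound for $\Delta$ and on the parameters of the case ($G,\eta_0,\gamma_0$ and $L$, respectively $\alpha,L_0,L_1,\lambda_0$, respectively $L_0,L_1$), such that $\mathbb E\|\nabla f(\widehat x)\|\le C\,T^{-1/3}$ for all $K\ge 0$,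 and for every $\varepsilon\in(0,1]$ the run of horizon $K=N(\varepsilon)$ makes at most $C\varepsilon^{-3}$ SFO calls and satisfies $\mathbb E\|\nabla f(\widehat x)\|\le\varepsilon$. -/

import Mathlib

open MeasureTheory ProbabilityTheory

noncomputable section

/-- State of a normalized STORM run: current iterate, current gradient estimator, and the log of all
stochastic first-order oracle (SFO) queries made so far. A query `(y, n)` asks for the stochastic
gradient at the point `y` with the `n`-th sample. -/
structure NstormState (d : ℕ) where
  x : EuclideanSpace ℝ (Fin d)
  v : EuclideanSpace ℝ (Fin d)
  queries : List (EuclideanSpace ℝ (Fin d) × ℕ)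

/-- Normalized STORM with one-sample initialization, run on the oracle `g` and the sample
sequence `s`. The direction `v / ‖v‖` is `0` when `v = 0`. -/
def nstorm {d : ℕ} {Ξ : Type*}
    (g : EuclideanSpace ℝ (Fin d) → Ξ → EuclideanSpace ℝ (Fin d))
    (x₀ : EuclideanSpace ℝ (Fin d)) (η γ : ℝ) (s : ℕ → Ξ) : ℕ → NstormState d
  | 0 => ⟨x₀, g x₀ (s 0), [(x₀, 0)]⟩
  | k + 1 =>
    let st := nstorm g x₀ η γ s k
    let x' := st.x - γ • (‖st.v‖⁻¹ • st.v)
    ⟨x', g x' (s (k + 1)) + (1 - η) • (st.v - g st.x (s (k + 1))),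
      (x', k + 1) :: (st.x, k + 1) :: st.queries⟩

/-- A stochastic optimization problem on `ℝ^d` together with the randomness of the algorithm.
`f` is the objective, `g x ξ` the stochastic gradient `∇f(x; ξ)`, `P` the law of an oracle sample,
`x₀` the starting point, `ξ 0, ξ 1, …` the fresh samples (i.i.d. with law `P`), and `κ K` the index
used to select the output of a run of horizon `K`: it is uniform on `{0, …, K}` and independent of
the samples. -/
structure StochasticSetup (d : ℕ) (Ω Ξ : Type*) [MeasurableSpace Ω] [MeasurableSpace Ξ] where
  f : EuclideanSpace ℝ (Fin d) → ℝ
  g : EuclideanSpace ℝ (Fin d) → Ξ → EuclideanSpace ℝ (Fin d)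
  P : Measure Ξ
  x₀ : EuclideanSpace ℝ (Fin d)
  μ : Measure Ω
  ξ : ℕ → Ω → Ξ
  κ : (K : ℕ) → Ω → Fin (K + 1)
  prob_P : IsProbabilityMeasure P
  prob_μ : IsProbabilityMeasure μ
  differentiable_f : Differentiable ℝ f
  measurable_g : Measurable (Function.uncurry g)
  measurable_ξ : ∀ n, Measurable (ξ n)
  law_ξ : ∀ n, μ.map (ξ n) = P
  indep_ξ : iIndepFun ξ μ
  measurable_κ : ∀ K, Measurable (κ K)
  uniform_κ : ∀ K i, μ.real {ω | κ K ω = i} = 1 / ((K : ℝ) + 1)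
  indep_κ : ∀ K, IndepFun (κ K) (fun ω n => ξ n ω) μ

namespace StochasticSetup

variable {d : ℕ} {Ω Ξ : Type*} [MeasurableSpace Ω] [MeasurableSpace Ξ]

/-- `f` is bounded from below. -/
def LowerBounded (S : StochasticSetup d Ω Ξ) : Prop := BddBelow (Set.range S.f)

/-- The initial gap `Δ = f(x₀) - inf f`. -/
def gap (S : StochasticSetup d Ω Ξ) : ℝ := S.f S.x₀ - ⨅ x, S.f x

/-- The oracle is unbiased and its variance is at most `B² ‖x - x₀‖² + G²`. -/
def BG0Oracle (S : StochasticSetup d Ω Ξ) (B G : ℝ) : Prop :=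
  0 ≤ B ∧ 0 ≤ G ∧ ∀ x,
    Integrable (S.g x) S.P ∧ ∫ z, S.g x z ∂S.P = gradient S.f x ∧
    Integrable (fun z => ‖S.g x z - gradient S.f x‖ ^ 2) S.P ∧
    ∫ z, ‖S.g x z - gradient S.f x‖ ^ 2 ∂S.P ≤ B ^ 2 * ‖x - S.x₀‖ ^ 2 + G ^ 2

/-- Mean-square smoothness with constant `L`. -/
def MeanSquareSmooth (S : StochasticSetup d Ω Ξ) (L : ℝ) : Prop :=
  ∀ x y,
    Integrable (fun z => ‖S.g y z - S.g x z‖ ^ 2) S.P ∧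
    ∫ z, ‖S.g y z - S.g x z‖ ^ 2 ∂S.P ≤ L ^ 2 * ‖y - x‖ ^ 2

/-- `max_{θ ∈ [0,1]} ‖∇f(θ y + (1 - θ) x; z)‖^α`. -/
def segmentMax (S : StochasticSetup d Ω Ξ) (α : ℝ) (x y : EuclideanSpace ℝ (Fin d)) (z : Ξ) : ℝ :=
  ⨆ θ : Set.Icc (0 : ℝ) 1, ‖S.g ((θ : ℝ) • y + (1 - (θ : ℝ)) • x) z‖ ^ α

/-- Expected `α`-symmetric generalized smoothness with constants `L₀, L₁`. Almost every sample
gradient is continuous (so that the maximum over a segment is attained), and all the expectations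
in the inequality are finite. -/
def ExpectedSymSmooth (S : StochasticSetup d Ω Ξ) (α L₀ L₁ : ℝ) : Prop :=
  (∀ᵐ z ∂S.P, Continuous fun x => S.g x z) ∧
  ∀ x y,
    Integrable (fun z => ‖S.g y z - S.g x z‖ ^ 2) S.P ∧
    Integrable (fun z => (L₀ + L₁ * S.segmentMax α x y z) ^ 2) S.P ∧
    ∫ z, ‖S.g y z - S.g x z‖ ^ 2 ∂S.P ≤
      ‖y - x‖ ^ 2 * ∫ z, (L₀ + L₁ * S.segmentMax α x y z) ^ 2 ∂S.P

/-- The (random) state of the algorithm with parameters `η, γ` after `k` transitions. -/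
def state (S : StochasticSetup d Ω Ξ) (η γ : ℝ) (k : ℕ) (ω : Ω) : NstormState d :=
  nstorm S.g S.x₀ η γ (fun n => S.ξ n ω) k

/-- The output of a run of horizon `K`: uniformly sampled from the iterates `x⁰, …, x^K`. -/
def output (S : StochasticSetup d Ω Ξ) (η γ : ℝ) (K : ℕ) (ω : Ω) : EuclideanSpace ℝ (Fin d) :=
  (S.state η γ (S.κ K ω) ω).x

/-- The number of SFO calls of a run of horizon `K`, which performs the transitions
`k = 0, …, K`. -/
def sfoCalls (S : StochasticSetup d Ω Ξ) (η γ : ℝ) (K : ℕ) (ω : Ω) : ℕ :=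
  (S.state η γ (K + 1) ω).queries.length

/-- `b₀ = E ‖v⁰ - ∇f(x⁰)‖`, with the one-sample initialization `v⁰ = ∇f(x⁰; ξ⁰)`. -/
def initError (S : StochasticSetup d Ω Ξ) : ℝ :=
  ∫ ω, ‖S.g S.x₀ (S.ξ 0 ω) - gradient S.f S.x₀‖ ∂S.μ

/-- `E ‖∇f(x̂)‖` is finite and at most `r`, for the run of horizon `K`. -/
def ExpGradNormLE (S : StochasticSetup d Ω Ξ) (η γ : ℝ) (K : ℕ) (r : ℝ) : Prop :=
  Integrable (fun ω => ‖gradient S.f (S.output η γ K ω)‖) S.μ ∧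
    ∫ ω, ‖gradient S.f (S.output η γ K ω)‖ ∂S.μ ≤ r

end StochasticSetup

/-- The schedule `c · T^(-2/3)` with `T = K + 1`. -/
def bvSchedule (c : ℝ) (K : ℕ) : ℝ := c * ((K : ℝ) + 1) ^ (-(2 / 3) : ℝ)

/-- `E ‖∇f(x̂)‖ ≤ C T^(-1/3)` for all horizons, and for every `ε ∈ (0, 1]` the run of horizon `N ε`
makes at most `C ε⁻³` SFO calls and its output is `ε`-stationary in expectation. -/
def StochasticSetup.CubicComplexity {d : ℕ} {Ω Ξ : Type*} [MeasurableSpace Ω] [MeasurableSpace Ξ]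
    (S : StochasticSetup d Ω Ξ) (η₀ γ₀ C : ℝ) (N : ℝ → ℕ) : Prop :=
  (∀ K : ℕ, S.ExpGradNormLE (bvSchedule η₀ K) (bvSchedule γ₀ K) K
    (C * ((K : ℝ) + 1) ^ (-(1 / 3) : ℝ))) ∧
  ∀ ε : ℝ, 0 < ε → ε ≤ 1 →
    (∀ ω, (S.sfoCalls (bvSchedule η₀ (N ε)) (bvSchedule γ₀ (N ε)) (N ε) ω : ℝ) ≤ C / ε ^ 3) ∧
    S.ExpGradNormLE (bvSchedule η₀ (N ε)) (bvSchedule γ₀ (N ε)) (N ε) ε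

def symK₀ (α L₀ : ℝ) : ℝ := 2 ^ ((2 - α) / (1 - α)) * L₀

def symK₁ (α L₁ : ℝ) : ℝ := 2 ^ ((2 - α) / (1 - α)) * L₁

def symK₂ (α L₁ : ℝ) : ℝ := (5 * L₁) ^ (1 / (1 - α))

def symLα (α L₁ : ℝ) : ℝ := 2 ^ (α / 2) * symK₁ α L₁

def symc (α : ℝ) : ℝ := (1 - α) * α ^ (α / (1 - α))

def symp (α : ℝ) : ℝ := α / (1 - α)

/-- The right-hand side of the bound under mean-square smoothness. -/
def bvBoundMSS (Δ b₀ G L η₀ γ₀ T : ℝ) : ℝ :=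
  (Δ / γ₀ + 2 * b₀ / η₀ + 2 * L * γ₀ / √η₀ + 2 * √η₀ * G) * T ^ (-(1 / 3) : ℝ)
    + L * γ₀ / 2 * T ^ (-(2 / 3) : ℝ)

/-- The right-hand side of the bound under expected `α`-symmetric smoothness, `α ∈ (0, 1)`. -/
def bvBoundAlpha (α Δ b₀ G L₀ L₁ η₀ γ₀ lam₀ T : ℝ) : ℝ :=
  (4 * Δ / γ₀ + 8 * b₀ / η₀
      + 8 * γ₀ / √η₀ *
        (symK₀ α L₀ + symc α * symLα α L₁ * lam₀ ^ (-symp α) + symLα α L₁ * G ^ α)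
      + 8 * √η₀ * G) * T ^ (-(1 / 3) : ℝ)
    + 8 * symK₂ α L₁ * γ₀ ^ (symp α + 1) / √η₀ * T ^ (-((1 + 2 * symp α) / 3))
    + 2 * γ₀ * (symK₀ α L₀ + symc α * symLα α L₁ * lam₀ ^ (-symp α)) * T ^ (-(2 / 3) : ℝ)
    + 4 * symK₂ α L₁ * γ₀ ^ (symp α + 1) * T ^ (-(2 * (symp α + 1) / 3))
    + 2 * symLα α L₁ * G ^ α * γ₀ * T ^ (-(2 / 3) : ℝ)

/-- The right-hand side of the bound under expected `1`-symmetric smoothness. -/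
def bvBoundOne (Δ b₀ G L₀ L₁ η₀ γ₀ T : ℝ) : ℝ :=
  (4 * Δ / γ₀ + 8 * b₀ / η₀
      + 8 * √(2 * Real.exp (3 / 4)) * γ₀ / √η₀ * (L₀ + 2 * L₁ * G)
      + 8 * √η₀ * G) * T ^ (-(1 / 3) : ℝ)
    + (4 * √2 * L₀ * γ₀ + 8 * √2 * L₁ * G * γ₀) * T ^ (-(2 / 3) : ℝ)

end

/-! All three cases reduce to one property, `AffineDrift`: over a step of length at most `γ` the
oracle moves in L² by at most `A + B‖∇f(x)‖`. Under mean-square smoothness `A = Lγ` and `B = 0`.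
Under symmetric smoothness the property comes from a barrier argument on the segment from `x` to `y`
(`ExpectedSymSmooth.integral_norm_sub_sq_le`): the L² distance of the oracle from its value at `x`
has a right slope controlled by the oracle's own L² size, so it stays below a line of slope `c` as
soon as `c` strictly dominates the slope at contact. The two `growth_lt` lemmas check this
domination for a `c` affine in `‖∇f(x)‖`.

Given `AffineDrift`, the estimator error satisfies `e' = (1-η)e + η·noise + (1-η)·drift` with
conditionally centered increments. Orthogonality costs only `√η G` for the noise, but a drift whose
variance grows with the gradient would require second moments of the gradient. The drift is
therefore split with weight `A/(A + B‖∇f(x)‖)`. The weighted part has second moment at most `A²`,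
and orthogonality gives `A/√η`; the rest has conditional first moment at most `B‖∇f(x)‖`, and the
plain contraction bounds its sum by `(B/η)∑E‖∇f‖`.

A normalized step decreases `f` by `γ‖∇f‖` up to `2γ‖e‖` and a remainder. Telescoping leaves
`∑E‖∇f‖` with the factor `1 - 2B/η - B`, which the smallness conditions keep away from zero
(`AffineDrift.sum_expGrad_le`). With `η` and `γ` of order `T^(-2/3)` the terms `1/(Tγ)`, `1/(Tη)`,
`√η` and `γ/√η` all have order `T^(-1/3)`. -/

open scoped Topology RealInnerProductSpace

/-! ### Second moments and Minkowski's inequality. -/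

section SecondMoments

variable {Ξ F : Type*} [MeasurableSpace Ξ] {P : Measure Ξ} [NormedAddCommGroup F]

theorem norm_toLp_two_eq_sqrt_integral {f : Ξ → F} (hf : MemLp f 2 P) :
    ‖hf.toLp f‖ = √(∫ z, ‖f z‖ ^ 2 ∂P) := by
  rw [Lp.norm_toLp, hf.eLpNorm_eq_integral_rpow_norm two_ne_zero ENNReal.ofNat_ne_top,
    ENNReal.toReal_ofReal (by positivity), Real.sqrt_eq_rpow]
  simp

/-- Minkowski's inequality for `√(∫ ‖f‖²)`. -/
theorem sqrt_integral_norm_add_sq_le {f g : Ξ → F} (hf : MemLp f 2 P) (hg : MemLp g 2 P) :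
    √(∫ z, ‖f z + g z‖ ^ 2 ∂P) ≤ √(∫ z, ‖f z‖ ^ 2 ∂P) + √(∫ z, ‖g z‖ ^ 2 ∂P) := by
  have h := norm_toLp_two_eq_sqrt_integral (hf.add hg)
  simp only [Pi.add_apply] at h
  rw [← h, ← norm_toLp_two_eq_sqrt_integral hf, ← norm_toLp_two_eq_sqrt_integral hg,
    MemLp.toLp_add]
  exact norm_add_le _ _

theorem integral_norm_le_sqrt_integral_norm_sq [IsProbabilityMeasure P] {f : Ξ → F}
    (hf : MemLp f 2 P) : ∫ z, ‖f z‖ ∂P ≤ √(∫ z, ‖f z‖ ^ 2 ∂P) := by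
  apply Real.le_sqrt_of_sq_le
  have h := variance_nonneg (fun z => ‖f z‖) P
  rw [variance_eq_sub hf.norm] at h
  simpa using h

variable [InnerProductSpace ℝ F] [CompleteSpace F]

/-- The cross term sees only the mean of `f`: it vanishes for centered increments, which is the
source of orthogonality, and `u = -E f` gives the variance bound below. -/
theorem integral_norm_const_add_sq [IsProbabilityMeasure P] {f : Ξ → F} (hf : Integrable f P)
    (hf2 : Integrable (fun z => ‖f z‖ ^ 2) P) (u : F) :
    Integrable (fun z => ‖u + f z‖ ^ 2) P ∧
      ∫ z, ‖u + f z‖ ^ 2 ∂P = ‖u‖ ^ 2 + 2 * ⟪u, ∫ z, f z ∂P⟫ + ∫ z, ‖f z‖ ^ 2 ∂P := by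
  have hi : Integrable (fun z => ⟪u, f z⟫) P := hf.const_inner u
  simp only [norm_add_sq_real]
  have h1 : Integrable (fun z => ‖u‖ ^ 2 + 2 * ⟪u, f z⟫) P :=
    (integrable_const _).add (hi.const_mul 2)
  refine ⟨h1.add hf2, ?_⟩
  rw [integral_add h1 hf2, integral_add (integrable_const _) (hi.const_mul 2),
    integral_const_mul, integral_inner hf]
  simp

theorem integral_norm_sub_integral_sq_le [IsProbabilityMeasure P] {f : Ξ → F}
    (hf : Integrable f P) (hf2 : Integrable (fun z => ‖f z‖ ^ 2) P) :
    Integrable (fun z => ‖f z - ∫ w, f w ∂P‖ ^ 2) P ∧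
      ∫ z, ‖f z - ∫ w, f w ∂P‖ ^ 2 ∂P ≤ ∫ z, ‖f z‖ ^ 2 ∂P := by
  obtain ⟨h1, h2⟩ := integral_norm_const_add_sq hf hf2 (-∫ w, f w ∂P)
  simp only [neg_add_eq_sub] at h1 h2
  refine ⟨h1, ?_⟩
  rw [h2, inner_neg_left, real_inner_self_eq_norm_sq, norm_neg]
  nlinarith [sq_nonneg ‖∫ w, f w ∂P‖]

end SecondMoments

/-- The concave power lies below its tangent at `s`: weighted AM-GM for `t` and `s`, rescaled by `s
^ (α - 1)`. -/
theorem rpow_le_tangent {α s t : ℝ} (hα : 0 < α) (hα1 : α ≤ 1) (hs : 0 < s) (ht : 0 ≤ t) :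
    t ^ α ≤ (1 - α) * s ^ α + α * s ^ (α - 1) * t := by
  have h := Real.geom_mean_le_arith_mean2_weighted hα.le (sub_nonneg.2 hα1) ht hs.le (by ring)
  have h2 : t ^ α = s ^ (α - 1) * (t ^ α * s ^ (1 - α)) := by
    rw [mul_left_comm, ← Real.rpow_add hs]; simp
  have h3 : s ^ α = s ^ (α - 1) * s := by
    rw [← Real.rpow_add_one hs.ne']; simp
  rw [h2, h3]
  have := mul_le_mul_of_nonneg_left h (Real.rpow_nonneg hs.le (α - 1))
  linarith

/-! ### Oracle moments and the growth of the oracle along a segment. -/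

namespace StochasticSetup

variable {d : ℕ} {Ω Ξ : Type*} [MeasurableSpace Ω] [MeasurableSpace Ξ]
  {S : StochasticSetup d Ω Ξ} {α L₀ L₁ G γ : ℝ}

instance (S : StochasticSetup d Ω Ξ) : IsProbabilityMeasure S.P := S.prob_P

instance (S : StochasticSetup d Ω Ξ) : IsProbabilityMeasure S.μ := S.prob_μ

theorem aestronglyMeasurable_g (S : StochasticSetup d Ω Ξ) (x : EuclideanSpace ℝ (Fin d)) :
    AEStronglyMeasurable (S.g x) S.P :=
  (S.measurable_g.comp measurable_prodMk_left).aestronglyMeasurable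

theorem BG0Oracle.memLp_noise (h : S.BG0Oracle 0 G) (x : EuclideanSpace ℝ (Fin d)) :
    MemLp (fun z => S.g x z - gradient S.f x) 2 S.P :=
  (memLp_two_iff_integrable_sq_norm
    ((S.aestronglyMeasurable_g x).sub aestronglyMeasurable_const)).2 (h.2.2 x).2.2.1

theorem BG0Oracle.memLp (h : S.BG0Oracle 0 G) (x : EuclideanSpace ℝ (Fin d)) :
    MemLp (S.g x) 2 S.P := by
  have h1 := (h.memLp_noise x).add (memLp_const (gradient S.f x))
  exact h1.ae_eq (Filter.Eventually.of_forall fun z => sub_add_cancel _ _)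

theorem BG0Oracle.sqrt_noise_le (h : S.BG0Oracle 0 G) (x : EuclideanSpace ℝ (Fin d)) :
    √(∫ z, ‖S.g x z - gradient S.f x‖ ^ 2 ∂S.P) ≤ G := by
  rw [Real.sqrt_le_left h.2.1]
  simpa using (h.2.2 x).2.2.2

theorem BG0Oracle.sqrt_le (h : S.BG0Oracle 0 G) (x : EuclideanSpace ℝ (Fin d)) :
    √(∫ z, ‖S.g x z‖ ^ 2 ∂S.P) ≤ ‖gradient S.f x‖ + G := by
  have h1 := sqrt_integral_norm_add_sq_le (memLp_const (μ := S.P) (gradient S.f x))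
    (h.memLp_noise x)
  have h2 := h.sqrt_noise_le x
  simp only [add_sub_cancel, integral_const, probReal_univ, one_smul,
    Real.sqrt_sq (norm_nonneg _)] at h1
  linarith

/-- By unbiasedness the gradient difference is the mean of the oracle difference, so its norm is at
most the L² norm of the latter. -/
theorem BG0Oracle.norm_gradient_sub_le (h : S.BG0Oracle 0 G) {c : ℝ} (hc : 0 ≤ c)
    {x y : EuclideanSpace ℝ (Fin d)} (hxy : ∫ z, ‖S.g y z - S.g x z‖ ^ 2 ∂S.P ≤ c ^ 2) :
    ‖gradient S.f y - gradient S.f x‖ ≤ c := by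
  rw [← (h.2.2 x).2.1, ← (h.2.2 y).2.1, ← integral_sub (h.2.2 y).1 (h.2.2 x).1]
  exact (norm_integral_le_integral_norm _).trans
    ((integral_norm_le_sqrt_integral_norm_sq ((h.memLp y).sub (h.memLp x))).trans
      ((Real.sqrt_le_left hc).2 hxy))

section Segment

theorem segmentMax_nonneg (S : StochasticSetup d Ω Ξ) (α : ℝ) (x y : EuclideanSpace ℝ (Fin d))
    (z : Ξ) : 0 ≤ S.segmentMax α x y z :=
  Real.iSup_nonneg fun _ => by positivity

theorem continuous_norm_rpow_segment (hα : 0 < α) {z : Ξ} (hz : Continuous fun x => S.g x z)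
    (x y : EuclideanSpace ℝ (Fin d)) :
    Continuous fun θ : ℝ => ‖S.g (θ • y + (1 - θ) • x) z‖ ^ α :=
  Continuous.rpow_const (hz.comp (by fun_prop)).norm fun _ => Or.inr hα.le

theorem bddAbove_segment (hα : 0 < α) {z : Ξ} (hz : Continuous fun x => S.g x z)
    (x y : EuclideanSpace ℝ (Fin d)) :
    BddAbove (Set.range fun θ : Set.Icc (0 : ℝ) 1 =>
      ‖S.g ((θ : ℝ) • y + (1 - (θ : ℝ)) • x) z‖ ^ α) :=
  (isCompact_range
    ((continuous_norm_rpow_segment hα hz x y).comp continuous_subtype_val)).bddAbove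

theorem segment_reparam (x y : EuclideanSpace ℝ (Fin d)) (t θ τ : ℝ) :
    t • (τ • y + (1 - τ) • x) + (1 - t) • (θ • y + (1 - θ) • x)
      = (t * τ + (1 - t) * θ) • y + (1 - (t * τ + (1 - t) * θ)) • x := by
  module

theorem segmentMax_le_of_mem (hα : 0 < α) {z : Ξ} (hz : Continuous fun x => S.g x z)
    (x y : EuclideanSpace ℝ (Fin d)) {θ τ : ℝ} (hθ : θ ∈ Set.Icc (0 : ℝ) 1)
    (hτ : τ ∈ Set.Icc (0 : ℝ) 1) :
    S.segmentMax α (θ • y + (1 - θ) • x) (τ • y + (1 - τ) • x) z ≤ S.segmentMax α x y z := by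
  refine ciSup_le fun t => ?_
  have ht : (t : ℝ) * τ + (1 - t) * θ ∈ Set.Icc (0 : ℝ) 1 :=
    convex_Icc (0 : ℝ) 1 hτ hθ t.2.1 (sub_nonneg.2 t.2.2) (by ring)
  rw [segment_reparam]
  exact le_ciSup (bddAbove_segment hα hz x y) ⟨_, ht⟩

/-- As the segment shrinks to a point, continuity of the sample gradient collapses the maximum to
the value at that point. This turns the segment maximum into a pointwise slope. -/
theorem tendsto_segmentMax (hα : 0 < α) {z : Ξ} (hz : Continuous fun x => S.g x z)
    (x y : EuclideanSpace ℝ (Fin d)) (θ : ℝ) :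
    Filter.Tendsto
      (fun τ : ℝ => S.segmentMax α (θ • y + (1 - θ) • x) (τ • y + (1 - τ) • x) z)
      (𝓝 θ) (𝓝 (‖S.g (θ • y + (1 - θ) • x) z‖ ^ α)) := by
  rw [Metric.tendsto_nhds]
  intro ε hε
  have hc := (continuous_norm_rpow_segment hα hz x y).continuousAt (x := θ)
  obtain ⟨δ, hδ, h⟩ := Metric.continuousAt_iff.1 hc (ε / 2) (half_pos hε)
  filter_upwards [Metric.ball_mem_nhds θ hδ] with τ hτ
  have hlow : ‖S.g (θ • y + (1 - θ) • x) z‖ ^ α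
      ≤ S.segmentMax α (θ • y + (1 - θ) • x) (τ • y + (1 - τ) • x) z := by
    have := le_ciSup (bddAbove_segment hα hz (θ • y + (1 - θ) • x) (τ • y + (1 - τ) • x))
      ⟨0, by simp⟩
    simpa [segmentMax] using this
  have hup : S.segmentMax α (θ • y + (1 - θ) • x) (τ • y + (1 - τ) • x) z
      ≤ ‖S.g (θ • y + (1 - θ) • x) z‖ ^ α + ε / 2 := by
    refine ciSup_le fun t => ?_
    rw [segment_reparam]
    have hball : dist ((t : ℝ) * τ + (1 - t) * θ) θ < δ := by
      have h1 : (t : ℝ) * τ + (1 - t) * θ - θ = t * (τ - θ) := by ring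
      rw [Real.dist_eq, h1, abs_mul, abs_of_nonneg t.2.1]
      rw [Metric.mem_ball, Real.dist_eq] at hτ
      nlinarith [t.2.2, abs_nonneg (τ - θ)]
    have := h hball
    rw [Real.dist_eq, abs_lt] at this
    linarith
  rw [Real.dist_eq, abs_lt]
  constructor <;> linarith

end Segment

/-- A quantity bounding the growth of the `L²` oracle difference along a segment bounds the
oracle difference at its end point. -/
theorem ExpectedSymSmooth.integral_norm_sub_sq_le (hS : S.ExpectedSymSmooth α L₀ L₁)
    (h : S.BG0Oracle 0 G) (hα : 0 < α) (hα1 : α ≤ 1) (hL₀ : 0 < L₀) (hL₁ : 0 < L₁)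
    (hγ : 0 < γ) {x y : EuclideanSpace ℝ (Fin d)} (hxy : ‖y - x‖ ≤ γ) {c : ℝ} (hc0 : 0 < c)
    (hc : γ * (L₀ + L₁ * (‖gradient S.f x‖ + G + c) ^ α) < c) :
    ∫ z, ‖S.g y z - S.g x z‖ ^ 2 ∂S.P ≤ c ^ 2 := by
  set X : ℝ → EuclideanSpace ℝ (Fin d) := fun θ => θ • y + (1 - θ) • x with hX
  have hXsub : ∀ θ τ, X τ - X θ = (τ - θ) • (y - x) := fun θ τ => by simp only [hX]; module
  set H : ℝ → ℝ := fun θ => √(∫ z, ‖S.g (X θ) z - S.g x z‖ ^ 2 ∂S.P) with hH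
  set J : ℝ → ℝ → ℝ := fun θ τ => √(∫ z, (L₀ + L₁ * S.segmentMax α (X θ) (X τ) z) ^ 2 ∂S.P)
    with hJ
  set I : ℝ → ℝ := fun θ => √(∫ z, (L₀ + L₁ * ‖S.g (X θ) z‖ ^ α) ^ 2 ∂S.P) with hI
  -- Minkowski, with the smoothness inequality applied to the subsegment from `X θ` to `X τ` and not
  -- to the whole of `[x, y]`.
  have hstep : ∀ θ τ, H τ - H θ ≤ |τ - θ| * ‖y - x‖ * J θ τ := by
    intro θ τ
    have h1 := sqrt_integral_norm_add_sq_le ((h.memLp (X τ)).sub (h.memLp (X θ)))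
      ((h.memLp (X θ)).sub (h.memLp x))
    simp only [Pi.sub_apply, sub_add_sub_cancel] at h1
    have h2 := Real.sqrt_le_sqrt (hS.2 (X θ) (X τ)).2.2
    rw [Real.sqrt_mul (by positivity), Real.sqrt_sq (norm_nonneg _), hXsub, norm_smul,
      Real.norm_eq_abs] at h2
    simp only [hH, hJ]
    linarith
  -- The square for the full segment is integrable and dominates every subsegment; it serves both
  -- for the Lipschitz constant of `H` and for dominated convergence.
  have hdom : ∀ θ ∈ Set.Icc (0 : ℝ) 1, ∀ τ ∈ Set.Icc (0 : ℝ) 1, ∀ᵐ z ∂S.P,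
      (L₀ + L₁ * S.segmentMax α (X θ) (X τ) z) ^ 2 ≤ (L₀ + L₁ * S.segmentMax α x y z) ^ 2 := by
    intro θ hθ τ hτ
    filter_upwards [hS.1] with z hz
    have h1 := segmentMax_le_of_mem hα hz x y hθ hτ
    have h2 := S.segmentMax_nonneg α (X θ) (X τ) z
    gcongr
  have hJle : ∀ θ ∈ Set.Icc (0 : ℝ) 1, ∀ τ ∈ Set.Icc (0 : ℝ) 1,
      J θ τ ≤ √(∫ z, (L₀ + L₁ * S.segmentMax α x y z) ^ 2 ∂S.P) := fun θ hθ τ hτ =>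
    Real.sqrt_le_sqrt (integral_mono_ae (hS.2 _ _).2.1 (hS.2 _ _).2.1 (hdom θ hθ τ hτ))
  have hcont : ContinuousOn H (Set.Icc 0 1) := by
    have hlip : LipschitzOnWith
        (Real.toNNReal (‖y - x‖ * √(∫ z, (L₀ + L₁ * S.segmentMax α x y z) ^ 2 ∂S.P)))
        H (Set.Icc 0 1) := by
      refine LipschitzOnWith.of_le_add_mul _ fun τ hτ θ hθ => ?_
      rw [Real.coe_toNNReal _ (by positivity), Real.dist_eq]
      have h1 := hstep θ τ
      have h2 : |τ - θ| * ‖y - x‖ * J θ τ ≤ |τ - θ| * ‖y - x‖ * _ :=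
        mul_le_mul_of_nonneg_left (hJle θ hθ τ hτ) (by positivity)
      linarith
    exact hlip.continuousOn
  have hJlim : ∀ θ ∈ Set.Ico (0 : ℝ) 1, Filter.Tendsto (J θ) (𝓝[>] θ) (𝓝 (I θ)) := by
    intro θ hθ
    refine (Real.continuous_sqrt.tendsto _).comp ?_
    refine tendsto_integral_filter_of_dominated_convergence
      (fun z => (L₀ + L₁ * S.segmentMax α x y z) ^ 2)
      (Filter.Eventually.of_forall fun τ => (hS.2 _ _).2.1.aestronglyMeasurable) ?_
      (hS.2 _ _).2.1 ?_
    · filter_upwards [Ioo_mem_nhdsGT hθ.2] with τ hτ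
      filter_upwards [hdom θ ⟨hθ.1, hθ.2.le⟩ τ ⟨hθ.1.trans hτ.1.le, hτ.2.le⟩] with z hz
      rwa [Real.norm_eq_abs, abs_of_nonneg (sq_nonneg _)]
    · filter_upwards [hS.1] with z hz
      exact (((tendsto_segmentMax hα hz x y θ).mono_left nhdsWithin_le_nhds).const_mul L₁
        |>.const_add L₀).pow 2
  -- The tangent at `s` replaces the power by an affine function, to which Minkowski applies. Since
  -- the tangent touches at `s`, evaluating it at the L² bound `s` returns exactly `L₀ + L₁ s ^ α`.
  have hIle : ∀ θ s, 0 < s → √(∫ z, ‖S.g (X θ) z‖ ^ 2 ∂S.P) ≤ s → I θ ≤ L₀ + L₁ * s ^ α := by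
    intro θ s hs hle
    set a := L₀ + L₁ * ((1 - α) * s ^ α) with ha
    set b := L₁ * (α * s ^ (α - 1)) with hb
    have ha0 : 0 ≤ a := by have := sub_nonneg.2 hα1; positivity
    have hb0 : 0 ≤ b := by positivity
    have hm := ((h.memLp (X θ)).norm.const_mul b)
    have h1 : I θ ≤ √(∫ z, ‖a + b * ‖S.g (X θ) z‖‖ ^ 2 ∂S.P) := by
      refine Real.sqrt_le_sqrt (integral_mono_of_nonneg
        (Filter.Eventually.of_forall fun z => sq_nonneg _) ?_
        (Filter.Eventually.of_forall fun z => ?_))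
      · exact ((memLp_const a).add hm).integrable_norm_pow two_ne_zero
      · have h3 := rpow_le_tangent hα hα1 hs (norm_nonneg (S.g (X θ) z))
        have h4 : L₀ + L₁ * ‖S.g (X θ) z‖ ^ α ≤ a + b * ‖S.g (X θ) z‖ := by
          rw [ha, hb]
          nlinarith [mul_le_mul_of_nonneg_left h3 hL₁.le]
        have h5 : 0 ≤ a + b * ‖S.g (X θ) z‖ := by positivity
        simp only [Real.norm_eq_abs, sq_abs]
        exact pow_le_pow_left₀ (by positivity) h4 2
    have h2 := sqrt_integral_norm_add_sq_le (memLp_const (μ := S.P) a) hm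
    simp only [integral_const, probReal_univ, one_smul, Real.sqrt_sq (norm_nonneg _), norm_mul,
      mul_pow, norm_norm, integral_const_mul] at h2
    rw [Real.sqrt_mul (by positivity), Real.sqrt_sq (norm_nonneg _), Real.norm_of_nonneg ha0,
      Real.norm_of_nonneg hb0] at h2
    have h3 : a + b * s = L₀ + L₁ * s ^ α := by
      have : s ^ (α - 1) * s = s ^ α := by rw [← Real.rpow_add_one hs.ne']; simp
      rw [ha, hb]
      linear_combination L₁ * α * this
    calc I θ ≤ _ := h1
      _ ≤ _ := h2
      _ ≤ a + b * s := by gcongr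
      _ = _ := h3
  have hG : 0 ≤ G := h.2.1
  -- Barrier `c θ`: only at a contact `H θ = c θ` must the slope bound be strictly below `c`. There
  -- `H θ ≤ c`, so the oracle at `X θ` has L² norm at most `‖∇f(x)‖ + G + c`, and `hc` applies.
  have key := image_le_of_liminf_slope_right_lt_deriv_boundary (f := H)
    (f' := fun θ => ‖y - x‖ * I θ) (a := 0) (b := 1) hcont
    (fun θ hθ r hr => by
      have hl := ((hJlim θ hθ).const_mul ‖y - x‖).eventually_lt_const hr
      refine Filter.Eventually.frequently ?_
      filter_upwards [hl, self_mem_nhdsWithin] with τ h1 h2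
      have h2' : 0 < τ - θ := sub_pos.2 h2
      refine lt_of_le_of_lt ?_ h1
      rw [slope_def_field, div_le_iff₀ h2']
      have := hstep θ τ
      rw [abs_of_pos h2'] at this
      linarith)
    (B := fun θ => c * θ) (B' := fun _ => c)
    (by simp [hH, hX])
    (fun θ => by simpa using (hasDerivAt_id θ).const_mul c)
    (fun θ hθ heq => by
      have h1 : √(∫ z, ‖S.g (X θ) z‖ ^ 2 ∂S.P) ≤ ‖gradient S.f x‖ + G + c := by
        have h2 := sqrt_integral_norm_add_sq_le ((h.memLp (X θ)).sub (h.memLp x)) (h.memLp x)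
        simp only [Pi.sub_apply, sub_add_cancel] at h2
        have h3 := h.sqrt_le x
        have h4 : H θ ≤ c := by rw [heq]; nlinarith [hθ.2]
        simp only [hH] at h4
        linarith
      have h2 := hIle θ _ (by positivity) h1
      refine lt_of_le_of_lt ?_ hc
      exact mul_le_mul hxy h2 (Real.sqrt_nonneg _) hγ.le)
  have h1 := key (Set.right_mem_Icc.2 zero_le_one)
  simp only [hH, hX, one_smul, sub_self, zero_smul, add_zero, mul_one] at h1
  rwa [Real.sqrt_le_left hc0.le] at h1

end StochasticSetup

/-! ### Normalized directions and descent inequalities. -/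

/-- The inner product of `u` with the normalized direction `-v / ‖v‖` of an estimator `v` of `u`. -/
theorem inner_neg_normalized_le {E : Type*} [NormedAddCommGroup E] [InnerProductSpace ℝ E]
    (u v : E) :
    ⟪u, -(‖v‖⁻¹ • v)⟫ ≤ -‖u‖ + 2 * ‖v - u‖ := by
  rcases eq_or_ne v 0 with rfl | hv
  · simp [two_mul]
  · have hv' : 0 < ‖v‖ := norm_pos_iff.2 hv
    have h1 : ⟪u, ‖v‖⁻¹ • v⟫ = ‖v‖ - ⟪v - u, ‖v‖⁻¹ • v⟫ := by
      rw [inner_sub_left, real_inner_smul_right v v, real_inner_self_eq_norm_sq]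
      field_simp
      ring
    have h2 := real_inner_le_norm (v - u) (‖v‖⁻¹ • v)
    rw [norm_smul, norm_inv, norm_norm, inv_mul_cancel₀ hv'.ne', mul_one] at h2
    have h3 := norm_sub_norm_le u v
    rw [norm_sub_rev] at h3
    rw [inner_neg_right]
    linarith

section Descent

variable {E : Type*} [NormedAddCommGroup E] [InnerProductSpace ℝ E] [CompleteSpace E] {f : E → ℝ}

/-- The mean value inequality for `f` minus its linearization at `x`. Only the oscillation of the
gradient on the ball enters, so no factor `1/2` is gained. -/
theorem le_add_inner_gradient_add (hf : Differentiable ℝ f) {x y : E} {γ c : ℝ}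
    (hc : ∀ w, ‖w - x‖ ≤ γ → ‖gradient f w - gradient f x‖ ≤ c) (hxy : ‖y - x‖ ≤ γ) :
    f y ≤ f x + ⟪gradient f x, y - x⟫ + γ * c := by
  have hγ : 0 ≤ γ := (norm_nonneg _).trans hxy
  have hc0 : 0 ≤ c := (norm_nonneg _).trans (hc y hxy)
  have h1 := (convex_closedBall x γ).norm_image_sub_le_of_norm_fderiv_le' (𝕜 := ℝ) (f := f)
    (φ := fderiv ℝ f x) (C := c) (fun w _ => hf w)
    (fun w hw => by
      have := hc w (by simpa [dist_eq_norm] using hw)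
      rw [gradient, gradient, ← map_sub, LinearIsometryEquiv.norm_map] at this
      exact this)
    (Metric.mem_closedBall_self hγ) (by simpa [dist_eq_norm] using hxy : y ∈ _)
  have h2 : fderiv ℝ f x (y - x) = ⟪gradient f x, y - x⟫ := by
    rw [gradient, InnerProductSpace.toDual_symm_apply]
  rw [h2] at h1
  have h3 := (abs_le.1 h1).2
  nlinarith [mul_le_mul_of_nonneg_left hxy hc0]

/-- Along the segment, `f` minus its quadratic upper model has nonpositive derivative. The resulting
`1/2` is needed for the sharp second-order term in the mean-square case. -/
theorem le_add_inner_gradient_add_of_lipschitz (hf : Differentiable ℝ f) {L : ℝ}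
    (hlip : ∀ x y, ‖gradient f y - gradient f x‖ ≤ L * ‖y - x‖) (x y : E) :
    f y ≤ f x + ⟪gradient f x, y - x⟫ + L / 2 * ‖y - x‖ ^ 2 := by
  set s := y - x with hs
  have hderiv : ∀ t : ℝ, HasDerivAt
      (fun t : ℝ => f (x + t • s) - t * ⟪gradient f x, s⟫ - L / 2 * ‖s‖ ^ 2 * t ^ 2)
      (⟪gradient f (x + t • s), s⟫ - ⟪gradient f x, s⟫ - L * ‖s‖ ^ 2 * t) t := by
    intro t
    have h1 : HasDerivAt (fun t : ℝ => x + t • s) s t := by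
      simpa using ((hasDerivAt_id t).smul_const s).const_add x
    have h2 : HasDerivAt (fun t : ℝ => f (x + t • s)) (⟪gradient f (x + t • s), s⟫) t := by
      have := (hf (x + t • s)).hasFDerivAt.comp_hasDerivAt t h1
      rwa [← InnerProductSpace.toDual_symm_apply] at this
    have h3 := (h2.sub ((hasDerivAt_id t).mul_const ⟪gradient f x, s⟫)).sub
      (((hasDerivAt_id t).pow 2).const_mul (L / 2 * ‖s‖ ^ 2))
    convert! h3 using 1
    simp
    ring
  have hanti : AntitoneOn
      (fun t : ℝ => f (x + t • s) - t * ⟪gradient f x, s⟫ - L / 2 * ‖s‖ ^ 2 * t ^ 2)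
      (Set.Icc 0 1) := by
    refine antitoneOn_of_deriv_nonpos (convex_Icc 0 1)
      (fun t _ => (hderiv t).continuousAt.continuousWithinAt)
      (fun t _ => (hderiv t).differentiableAt.differentiableWithinAt) fun t ht => ?_
    rw [interior_Icc] at ht
    rw [(hderiv t).deriv, ← inner_sub_left]
    have h1 := real_inner_le_norm (gradient f (x + t • s) - gradient f x) s
    have h2 := hlip x (x + t • s)
    rw [add_sub_cancel_left, norm_smul, Real.norm_of_nonneg ht.1.le] at h2
    nlinarith [norm_nonneg s]
  have h := hanti (Set.left_mem_Icc.2 zero_le_one) (Set.right_mem_Icc.2 zero_le_one) zero_le_one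
  simp only [one_smul, zero_smul, hs, add_sub_cancel, add_zero] at h
  linarith

end Descent

/-! ### Scalar inequalities behind the barrier argument. -/

/-- Young's inequality `t ^ α ≤ λ t + (1 - α) (α / λ) ^ (α / (1 - α))`. -/
theorem rpow_le_symc_add {α t lam : ℝ} (hα : 0 < α) (hα1 : α < 1) (ht : 0 ≤ t) (hl : 0 < lam) :
    t ^ α ≤ symc α * lam ^ (-symp α) + lam * t := by
  have h1α : 0 < 1 - α := sub_pos.2 hα1
  -- The tangency point at which the slope `α s ^ (α - 1)` equals `lam`.
  set s := (α / lam) ^ (1 / (1 - α)) with hs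
  have hs0 : 0 < s := by positivity
  have h := rpow_le_tangent hα hα1.le hs0 ht
  have h1 : s ^ α = α ^ symp α * lam ^ (-symp α) := by
    have : 1 / (1 - α) * α = symp α := by unfold symp; ring
    rw [hs, ← Real.rpow_mul (by positivity), this, Real.div_rpow hα.le hl.le,
      Real.rpow_neg hl.le, div_eq_mul_inv]
  have h2 : s ^ (α - 1) = lam / α := by
    rw [hs, ← Real.rpow_mul (by positivity)]
    have : 1 / (1 - α) * (α - 1) = -1 := by field_simp; ring
    rw [this, Real.rpow_neg_one, inv_div]
  rw [h1, h2] at h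
  have h3 : α * (lam / α) * t = lam * t := by field_simp
  rw [h3] at h
  unfold symc
  unfold symp at h ⊢
  linarith

theorem four_mul_le_two_rpow_mul {α L : ℝ} (hα : 0 < α) (hα1 : α < 1) (hL : 0 ≤ L) :
    4 * L ≤ 2 ^ ((2 - α) / (1 - α)) * L := by
  have h1 : (2 : ℝ) ≤ (2 - α) / (1 - α) := by
    rw [le_div_iff₀ (sub_pos.2 hα1)]; linarith
  have h2 : (2 : ℝ) ^ (2 : ℝ) ≤ 2 ^ ((2 - α) / (1 - α)) :=
    Real.rpow_le_rpow_of_exponent_le one_le_two h1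
  have h3 : (2 : ℝ) ^ (2 : ℝ) = 4 := by norm_num
  rw [h3] at h2
  gcongr

theorem four_mul_le_symLα {α L₁ : ℝ} (hα : 0 < α) (hα1 : α < 1) (hL : 0 ≤ L₁) :
    4 * L₁ ≤ symLα α L₁ := by
  have h1 := four_mul_le_two_rpow_mul hα hα1 hL
  have h2 : (1 : ℝ) ≤ 2 ^ (α / 2) := Real.one_le_rpow one_le_two (by positivity)
  unfold symLα symK₁
  nlinarith

theorem symLα_pos {α L₁ : ℝ} (hL : 0 < L₁) : 0 < symLα α L₁ := by
  unfold symLα symK₁; positivity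

theorem symK₀_pos {α L₀ : ℝ} (hL : 0 < L₀) : 0 < symK₀ α L₀ := by
  unfold symK₀; positivity

theorem symK₂_pos {α L₁ : ℝ} (hL : 0 < L₁) : 0 < symK₂ α L₁ := by
  unfold symK₂; positivity

theorem symc_nonneg {α : ℝ} (hα : 0 < α) (hα1 : α < 1) : 0 ≤ symc α := by
  have := sub_pos.2 hα1
  unfold symc; positivity

theorem symp_pos {α : ℝ} (hα : 0 < α) (hα1 : α < 1) : 0 < symp α :=
  div_pos hα (sub_pos.2 hα1)

theorem symp_add_one {α : ℝ} (hα1 : α < 1) : symp α + 1 = 1 / (1 - α) := by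
  have := (sub_pos.2 hα1).ne'
  unfold symp; field_simp; ring

/-- The growth condition along segments, for exponents in `(0, 1)`. -/
theorem growth_lt_of_lt_one {α L₀ L₁ G N γ lam : ℝ} (hα : 0 < α) (hα1 : α < 1) (hL₀ : 0 < L₀)
    (hL₁ : 0 < L₁) (hG : 0 ≤ G) (hN : 0 ≤ N) (hγ : 0 < γ) (hl : 0 < lam) {c : ℝ}
    (hc : c = γ * (symK₀ α L₀ + symc α * symLα α L₁ * lam ^ (-symp α) + symLα α L₁ * G ^ α)
      + symK₂ α L₁ * γ ^ (symp α + 1) + γ * symLα α L₁ * lam * N) :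
    0 < c ∧ γ * (L₀ + L₁ * (N + G + c) ^ α) < c := by
  have hLα := symLα_pos (α := α) hL₁
  have hLα4 := four_mul_le_symLα hα hα1 hL₁.le
  have hK₀ : 4 * L₀ ≤ symK₀ α L₀ := four_mul_le_two_rpow_mul hα hα1 hL₀.le
  have hK₂ := symK₂_pos (α := α) hL₁
  have hcα := symc_nonneg hα hα1
  have hY := rpow_le_symc_add hα hα1 hN hl
  have hNα : 0 ≤ N ^ α := by positivity
  have hGα : 0 ≤ G ^ α := by positivity
  have hK₂γ : 0 < symK₂ α L₁ * γ ^ (symp α + 1) := by positivity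
  -- Young's inequality trades the `lam`-dependent part of `c` for `N ^ α`. The factor 4 makes all
  -- terms of the target not involving `c ^ α` at most `c / 4`.
  have hlow : γ * (4 * L₀ + 4 * L₁ * G ^ α + 4 * L₁ * N ^ α) + symK₂ α L₁ * γ ^ (symp α + 1)
      ≤ c := by
    have h1 : symLα α L₁ * N ^ α ≤ symLα α L₁ * (symc α * lam ^ (-symp α) + lam * N) := by gcongr
    have h2 : 4 * L₁ * G ^ α ≤ symLα α L₁ * G ^ α := by gcongr
    have h3 : 4 * L₁ * N ^ α ≤ symLα α L₁ * N ^ α := by gcongr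
    have h4 : 4 * L₀ + 4 * L₁ * G ^ α + 4 * L₁ * N ^ α ≤ symK₀ α L₀ + symLα α L₁ * G ^ α
        + symLα α L₁ * (symc α * lam ^ (-symp α) + lam * N) := by linarith
    have h5 := mul_le_mul_of_nonneg_left h4 hγ.le
    rw [hc]
    linarith
  have hc0 : 0 < c := by
    have : 0 < γ * (4 * L₀ + 4 * L₁ * G ^ α + 4 * L₁ * N ^ α) := by positivity
    linarith
  refine ⟨hc0, ?_⟩
  have hsub : (N + G + c) ^ α ≤ N ^ α + G ^ α + c ^ α :=
    (Real.rpow_add_le_add_rpow (by positivity) hc0.le hα.le hα1.le).trans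
      (by gcongr; exact Real.rpow_add_le_add_rpow hN hG hα.le hα1.le)
  -- The `symK₂` term gives `c ≥ (5 L₁ γ) ^ (1 / (1 - α))`, hence `γ L₁ c ^ α ≤ c / 5`. The total is
  -- at most `c / 4 + c / 5 < c`.
  have hpow : 5 * L₁ * γ ≤ c ^ (1 - α) := by
    have h1α := sub_pos.2 hα1
    have h1 : symK₂ α L₁ * γ ^ (symp α + 1) = (5 * L₁ * γ) ^ (1 / (1 - α)) := by
      rw [symp_add_one hα1, symK₂, ← Real.mul_rpow (by positivity) hγ.le]
    have h2 : (5 * L₁ * γ) ^ (1 / (1 - α)) ≤ c := by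
      rw [← h1]
      have : 0 ≤ γ * (4 * L₀ + 4 * L₁ * G ^ α + 4 * L₁ * N ^ α) := by positivity
      linarith
    have h3 := Real.rpow_le_rpow (by positivity) h2 h1α.le
    rwa [← Real.rpow_mul (by positivity), one_div_mul_cancel h1α.ne', Real.rpow_one] at h3
  have hcc : 5 * (γ * L₁ * c ^ α) ≤ c := by
    have h1 : c = c ^ (1 - α) * c ^ α := by rw [← Real.rpow_add hc0]; simp
    have h2 : 0 ≤ c ^ α := by positivity
    calc 5 * (γ * L₁ * c ^ α) = 5 * L₁ * γ * c ^ α := by ring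
      _ ≤ c ^ (1 - α) * c ^ α := by gcongr
      _ = c := h1.symm
  have h1 : γ * L₁ * (N + G + c) ^ α ≤ γ * L₁ * (N ^ α + G ^ α + c ^ α) := by gcongr
  have h2 : 0 < γ * L₀ := by positivity
  have h3 : 0 ≤ γ * L₁ * N ^ α := by positivity
  have h4 : 0 ≤ γ * L₁ * G ^ α := by positivity
  nlinarith

/-- The growth condition along segments, for the exponent `1`. -/
theorem growth_lt_of_one {L₀ L₁ G N γ : ℝ} (hL₀ : 0 < L₀) (hL₁ : 0 < L₁) (hG : 0 ≤ G)
    (hN : 0 ≤ N) (hγ : 0 < γ) (hγ1 : γ * (4 * √2 * L₁) ≤ 1) {c : ℝ}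
    (hc : c = √2 * γ * (L₀ + 2 * L₁ * G) + 2 * √2 * γ * L₁ * N) :
    0 < c ∧ γ * (L₀ + L₁ * (N + G + c) ^ (1 : ℝ)) < c := by
  have hs2 : √2 * √2 = 2 := Real.mul_self_sqrt zero_le_two
  have hs0 : 0 < √2 := by positivity
  have hs : 1.4 < √2 := Real.lt_sqrt_of_sq_lt (by norm_num)
  have hc0 : 0 < c := by rw [hc]; positivity
  refine ⟨hc0, ?_⟩
  rw [Real.rpow_one]
  -- Since `4√2 > 5`, feeding `c` back costs at most `c / 5`; the remaining terms are at most `c /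
  -- 1.4`, and the sum is still below `c`.
  have h1 : γ * L₁ ≤ 1 / 5 := by nlinarith [mul_pos hγ hL₁]
  have h2 : γ * L₁ * c ≤ 1 / 5 * c := by gcongr
  have h3 : 1.4 * (γ * (L₀ + 2 * L₁ * G + 2 * L₁ * N)) ≤ c := by
    rw [hc]
    have : 0 ≤ γ * (L₀ + 2 * L₁ * G + 2 * L₁ * N) := by positivity
    nlinarith
  have h4 : 0 < γ * L₀ := by positivity
  have h5 : 0 ≤ γ * L₁ * G := by positivity
  have h6 : 0 ≤ γ * L₁ * N := by positivity
  nlinarith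

theorem integrable_and_integral_le_of_lintegral_le {Ω : Type*} [MeasurableSpace Ω] {μ : Measure Ω}
    {f : Ω → ℝ} (hf : AEStronglyMeasurable f μ) (hf0 : ∀ ω, 0 ≤ f ω) {M : ℝ} (hM : 0 ≤ M)
    (h : ∫⁻ ω, ENNReal.ofReal (f ω) ∂μ ≤ ENNReal.ofReal M) :
    Integrable f μ ∧ ∫ ω, f ω ∂μ ≤ M := by
  refine ⟨⟨hf, ?_⟩, ?_⟩
  · rw [hasFiniteIntegral_iff_ofReal (Filter.Eventually.of_forall hf0)]
    exact h.trans_lt ENNReal.ofReal_lt_top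
  · rw [integral_eq_lintegral_of_nonneg_ae (Filter.Eventually.of_forall hf0) hf]
    exact ENNReal.toReal_le_of_le_ofReal hM h

/-! ### Adaptedness, conditioning on the past, and processes driven by a run. -/

namespace StochasticSetup

variable {d : ℕ} {Ω Ξ : Type*} [MeasurableSpace Ω] [MeasurableSpace Ξ]
  {S : StochasticSetup d Ω Ξ} {η γ : ℝ}

/-- The iterate `xᵏ` as a function of the sample sequence. -/
noncomputable def iterate (S : StochasticSetup d Ω Ξ) (η γ : ℝ) (k : ℕ) (s : ℕ → Ξ) :
    EuclideanSpace ℝ (Fin d) :=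
  (nstorm S.g S.x₀ η γ s k).x

/-- The gradient estimator `vᵏ` as a function of the sample sequence. -/
noncomputable def estimate (S : StochasticSetup d Ω Ξ) (η γ : ℝ) (k : ℕ) (s : ℕ → Ξ) :
    EuclideanSpace ℝ (Fin d) :=
  (nstorm S.g S.x₀ η γ s k).v

theorem iterate_succ (S : StochasticSetup d Ω Ξ) (η γ : ℝ) (k : ℕ) (s : ℕ → Ξ) :
    S.iterate η γ (k + 1) s
      = S.iterate η γ k s - γ • (‖S.estimate η γ k s‖⁻¹ • S.estimate η γ k s) := rfl

theorem estimate_succ (S : StochasticSetup d Ω Ξ) (η γ : ℝ) (k : ℕ) (s : ℕ → Ξ) :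
    S.estimate η γ (k + 1) s = S.g (S.iterate η γ (k + 1) s) (s (k + 1))
      + (1 - η) • (S.estimate η γ k s - S.g (S.iterate η γ k s) (s (k + 1))) := rfl

/-- The process `U₀ = 0`, `Uₖ₊₁ = a Uₖ + m(xᵏ, xᵏ⁺¹; ξᵏ⁺¹)` driven by a run. -/
noncomputable def accum (S : StochasticSetup d Ω Ξ) (η γ a : ℝ)
    (m : EuclideanSpace ℝ (Fin d) → EuclideanSpace ℝ (Fin d) → Ξ → EuclideanSpace ℝ (Fin d))
    (s : ℕ → Ξ) : ℕ → EuclideanSpace ℝ (Fin d)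
  | 0 => 0
  | k + 1 => a • S.accum η γ a m s k
      + m (S.iterate η γ k s) (S.iterate η γ (k + 1) s) (s (k + 1))

theorem norm_normalized_step_le {E : Type*} [NormedAddCommGroup E] [NormedSpace ℝ E]
    (hγ : 0 ≤ γ) (x v : E) : ‖x - γ • (‖v‖⁻¹ • v) - x‖ ≤ γ := by
  rw [sub_sub_cancel_left, norm_neg, norm_smul, norm_smul, norm_inv, norm_norm,
    Real.norm_of_nonneg hγ]
  exact mul_le_of_le_one_right hγ inv_mul_le_one

section Measurability

variable {Ω' : Type*} {mΩ' : MeasurableSpace Ω'} {ζ : ℕ → Ω' → Ξ} {k : ℕ}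

/-- The σ-algebra on `Ω'` is arbitrary, so that the same statement yields adaptedness when it is
taken to be `past k`. -/
theorem measurable_iterate_estimate (S : StochasticSetup d Ω Ξ) (η γ : ℝ)
    (hζ : ∀ j ≤ k, Measurable (ζ j)) :
    Measurable (fun ω => S.iterate η γ k fun n => ζ n ω) ∧
      Measurable (fun ω => S.estimate η γ k fun n => ζ n ω) := by
  induction k with
  | zero =>
    exact ⟨measurable_const, S.measurable_g.comp (measurable_const.prodMk (hζ 0 le_rfl))⟩
  | succ k ih =>
    obtain ⟨hx, hv⟩ := ih fun j hj => hζ j (hj.trans k.le_succ)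
    have hx' : Measurable (fun ω => S.iterate η γ (k + 1) fun n => ζ n ω) := by
      simp only [iterate_succ]
      exact hx.sub ((hv.norm.inv.smul hv).const_smul γ)
    refine ⟨hx', ?_⟩
    simp only [estimate_succ]
    exact (S.measurable_g.comp (hx'.prodMk (hζ _ le_rfl))).add
      ((hv.sub (S.measurable_g.comp (hx.prodMk (hζ _ le_rfl)))).const_smul (1 - η))

theorem measurable_accum (S : StochasticSetup d Ω Ξ) (η γ a : ℝ)
    {m : EuclideanSpace ℝ (Fin d) → EuclideanSpace ℝ (Fin d) → Ξ → EuclideanSpace ℝ (Fin d)}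
    (hm : Measurable fun p : (EuclideanSpace ℝ (Fin d) × EuclideanSpace ℝ (Fin d)) × Ξ =>
      m p.1.1 p.1.2 p.2)
    (hζ : ∀ j ≤ k, Measurable (ζ j)) :
    Measurable (fun ω => S.accum η γ a m (fun n => ζ n ω) k) := by
  induction k with
  | zero => exact measurable_const
  | succ k ih =>
    have hζ' : ∀ j ≤ k, Measurable (ζ j) := fun j hj => hζ j (hj.trans k.le_succ)
    exact ((ih hζ').const_smul a).add (hm.comp
      (((S.measurable_iterate_estimate η γ hζ').1.prodMk
        (S.measurable_iterate_estimate η γ hζ).1).prodMk (hζ _ le_rfl)))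

end Measurability

/-- The information carried by the samples `ξ⁰, …, ξᵏ`. -/
@[reducible] noncomputable def past (S : StochasticSetup d Ω Ξ) (k : ℕ) : MeasurableSpace Ω :=
  ⨆ j ∈ Set.Iic k, MeasurableSpace.comap (S.ξ j) inferInstance

theorem measurable_past (S : StochasticSetup d Ω Ξ) {j k : ℕ} (hj : j ≤ k) :
    Measurable[S.past k] (S.ξ j) :=
  measurable_iff_comap_le.2
    (le_iSup₂_of_le (f := fun j (_ : j ∈ Set.Iic k) =>
      MeasurableSpace.comap (S.ξ j) inferInstance) j hj le_rfl)

theorem past_le (S : StochasticSetup d Ω Ξ) (k : ℕ) : S.past k ≤ ‹MeasurableSpace Ω› :=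
  iSup₂_le fun j _ => (S.measurable_ξ j).comap_le

/-- Freezing: a fresh sample is independent of anything measurable in the past, so it can be
integrated out first. Nonnegative integrands make prior integrability unnecessary. -/
theorem lintegral_next (S : StochasticSetup d Ω Ξ) {β : Type*} [MeasurableSpace β] {k : ℕ}
    {H : Ω → β} (hH : Measurable[S.past k] H) {F : β × Ξ → ENNReal} (hF : Measurable F) :
    ∫⁻ ω, F (H ω, S.ξ (k + 1) ω) ∂S.μ = ∫⁻ ω, ∫⁻ z, F (H ω, z) ∂S.P ∂S.μ := by
  have hind : Indep (S.past k)
      (⨆ j ∈ ({k + 1} : Set ℕ), MeasurableSpace.comap (S.ξ j) inferInstance) S.μ :=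
    indep_iSup_of_disjoint (fun j => (S.measurable_ξ j).comap_le) S.indep_ξ
      (by simp)
  have hfun : IndepFun H (S.ξ (k + 1)) S.μ := by
    rw [IndepFun_iff_Indep]
    refine indep_of_indep_of_le_left (indep_of_indep_of_le_right hind ?_) hH.comap_le
    simp
  have hH' : Measurable H := hH.mono (S.past_le k) le_rfl
  have hmap := (indepFun_iff_map_prod_eq_prod_map_map hH'.aemeasurable
    (S.measurable_ξ (k + 1)).aemeasurable).1 hfun
  rw [← lintegral_map hF (hH'.prodMk (S.measurable_ξ (k + 1))), hmap, S.law_ξ,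
    lintegral_prod _ hF.aemeasurable, lintegral_map hF.lintegral_prod_right' hH']

theorem norm_iterate_succ_sub_le (S : StochasticSetup d Ω Ξ) (η : ℝ) (hγ : 0 ≤ γ) (k : ℕ)
    (s : ℕ → Ξ) : ‖S.iterate η γ (k + 1) s - S.iterate η γ k s‖ ≤ γ := by
  rw [iterate_succ]
  exact norm_normalized_step_le hγ _ _

section Accum

variable {m : EuclideanSpace ℝ (Fin d) → EuclideanSpace ℝ (Fin d) → Ξ → EuclideanSpace ℝ (Fin d)}
  {a : ℝ}

theorem measurable_accum_ξ (S : StochasticSetup d Ω Ξ) (η γ a : ℝ)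
    (hm : Measurable fun p : (EuclideanSpace ℝ (Fin d) × EuclideanSpace ℝ (Fin d)) × Ξ =>
      m p.1.1 p.1.2 p.2) (k : ℕ) :
    Measurable (fun ω => S.accum η γ a m (fun n => S.ξ n ω) k) :=
  S.measurable_accum η γ a hm fun j _ => S.measurable_ξ j

/-- Orthogonality of martingale increments: the second moments of a process driven by centered
increments add up. -/
theorem integral_norm_accum_le_sqrt (S : StochasticSetup d Ω Ξ) (η : ℝ) (hγ : 0 ≤ γ)
    (hm : Measurable fun p : (EuclideanSpace ℝ (Fin d) × EuclideanSpace ℝ (Fin d)) × Ξ =>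
      m p.1.1 p.1.2 p.2) {b M : ℝ} (hb : 0 ≤ b) (hM : 0 ≤ M) (habM : a ^ 2 * M + b ≤ M)
    (h : ∀ x y, ‖y - x‖ ≤ γ → Integrable (m x y) S.P ∧ ∫ z, m x y z ∂S.P = 0 ∧
      Integrable (fun z => ‖m x y z‖ ^ 2) S.P ∧ ∫ z, ‖m x y z‖ ^ 2 ∂S.P ≤ b) (k : ℕ) :
    Integrable (fun ω => ‖S.accum η γ a m (fun n => S.ξ n ω) k‖) S.μ ∧
      ∫ ω, ‖S.accum η γ a m (fun n => S.ξ n ω) k‖ ∂S.μ ≤ √M := by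
  have key : ∀ k, ∫⁻ ω, ENNReal.ofReal (‖S.accum η γ a m (fun n => S.ξ n ω) k‖ ^ 2) ∂S.μ
      ≤ ENNReal.ofReal M := by
    intro k
    induction k with
    | zero => simp [accum]
    | succ k ih =>
      -- The next iterate is written through the current iterate and estimator, so `F` depends only
      -- on the past and on the fresh sample.
      set F : (EuclideanSpace ℝ (Fin d) × EuclideanSpace ℝ (Fin d) × EuclideanSpace ℝ (Fin d)) × Ξ
          → ENNReal := fun p => ENNReal.ofReal
        (‖a • p.1.2.2 + m p.1.1 (p.1.1 - γ • (‖p.1.2.1‖⁻¹ • p.1.2.1)) p.2‖ ^ 2) with hF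
      have hFm : Measurable F := by
        have h1 : Measurable fun p : (EuclideanSpace ℝ (Fin d) × EuclideanSpace ℝ (Fin d) ×
            EuclideanSpace ℝ (Fin d)) × Ξ =>
              m p.1.1 (p.1.1 - γ • (‖p.1.2.1‖⁻¹ • p.1.2.1)) p.2 :=
          hm.comp (Measurable.prodMk (Measurable.prodMk (by fun_prop) (by fun_prop)) (by fun_prop))
        have h2 : Measurable fun p : (EuclideanSpace ℝ (Fin d) × EuclideanSpace ℝ (Fin d) ×
            EuclideanSpace ℝ (Fin d)) × Ξ => a • p.1.2.2 := by fun_prop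
        exact ((h2.add h1).norm.pow_const 2).ennreal_ofReal
      have hζ : ∀ j ≤ k, Measurable[S.past k] (S.ξ j) := fun j hj => S.measurable_past hj
      have hxv := S.measurable_iterate_estimate (mΩ' := S.past k) η γ hζ
      have hH : Measurable[S.past k] fun ω => (S.iterate η γ k (fun n => S.ξ n ω),
          S.estimate η γ k (fun n => S.ξ n ω), S.accum η γ a m (fun n => S.ξ n ω) k) :=
        hxv.1.prodMk (hxv.2.prodMk (S.measurable_accum (mΩ' := S.past k) η γ a hm hζ))
      have hnext := S.lintegral_next hH hFm
      calc ∫⁻ ω, ENNReal.ofReal (‖S.accum η γ a m (fun n => S.ξ n ω) (k + 1)‖ ^ 2) ∂S.μ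
          = _ := hnext
        _ ≤ ∫⁻ ω, (ENNReal.ofReal (a ^ 2)
              * ENNReal.ofReal (‖S.accum η γ a m (fun n => S.ξ n ω) k‖ ^ 2)
              + ENNReal.ofReal b) ∂S.μ := by
            refine lintegral_mono fun ω => ?_
            simp only [hF]
            -- With the past frozen the increment is centered, so the cross term disappears and the
            -- second moment obeys `M ↦ a² M + b`.
            obtain ⟨h1, h2, h3, h4⟩ := h (S.iterate η γ k fun n => S.ξ n ω) _
              (norm_normalized_step_le hγ _ (S.estimate η γ k fun n => S.ξ n ω))
            obtain ⟨h5, h6⟩ := integral_norm_const_add_sq h1 h3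
              (a • S.accum η γ a m (fun n => S.ξ n ω) k)
            rw [← ofReal_integral_eq_lintegral_ofReal h5
              (Filter.Eventually.of_forall fun _ => sq_nonneg _), h6, h2, inner_zero_right,
              ← ENNReal.ofReal_mul (sq_nonneg _), ← ENNReal.ofReal_add (by positivity) hb,
              norm_smul, mul_pow, Real.norm_eq_abs, sq_abs]
            exact ENNReal.ofReal_le_ofReal (by linarith)
        _ ≤ ENNReal.ofReal (a ^ 2) * ENNReal.ofReal M + ENNReal.ofReal b := by
            rw [lintegral_add_right _ measurable_const, lintegral_const_mul _
              (((S.measurable_accum_ξ η γ a hm k).norm.pow_const 2).ennreal_ofReal)]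
            simp only [lintegral_const, measure_univ, mul_one]
            gcongr
        _ ≤ ENNReal.ofReal M := by
            rw [← ENNReal.ofReal_mul (sq_nonneg _), ← ENNReal.ofReal_add (by positivity) hb]
            exact ENNReal.ofReal_le_ofReal habM
  have hmeas := S.measurable_accum_ξ η γ a hm k
  obtain ⟨h1, h2⟩ := integrable_and_integral_le_of_lintegral_le
    (hmeas.norm.pow_const 2).aestronglyMeasurable (fun ω => sq_nonneg _) hM (key k)
  have hLp : MemLp (fun ω => S.accum η γ a m (fun n => S.ξ n ω) k) 2 S.μ :=
    (memLp_two_iff_integrable_sq_norm hmeas.aestronglyMeasurable).2 h1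
  exact ⟨(hLp.integrable one_le_two).norm,
    (integral_norm_le_sqrt_integral_norm_sq hLp).trans (Real.sqrt_le_sqrt h2)⟩

/-- The first-moment counterpart: conditioning and the triangle inequality, without cancellation.
Its increments may grow with the current point, as no second moment of `r` is needed. -/
theorem integral_norm_accum_succ_le (S : StochasticSetup d Ω Ξ) (η : ℝ) (hγ : 0 ≤ γ) (ha : 0 ≤ a)
    (hm : Measurable fun p : (EuclideanSpace ℝ (Fin d) × EuclideanSpace ℝ (Fin d)) × Ξ =>
      m p.1.1 p.1.2 p.2) {r : EuclideanSpace ℝ (Fin d) → ℝ} (hr0 : ∀ x, 0 ≤ r x)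
    (hr : ∀ k, Integrable (fun ω => r (S.iterate η γ k fun n => S.ξ n ω)) S.μ)
    (h : ∀ x y, ‖y - x‖ ≤ γ → Integrable (fun z => ‖m x y z‖) S.P ∧
      ∫ z, ‖m x y z‖ ∂S.P ≤ r x) (k : ℕ) :
    Integrable (fun ω => ‖S.accum η γ a m (fun n => S.ξ n ω) k‖) S.μ ∧
      ∫ ω, ‖S.accum η γ a m (fun n => S.ξ n ω) (k + 1)‖ ∂S.μ
        ≤ a * ∫ ω, ‖S.accum η γ a m (fun n => S.ξ n ω) k‖ ∂S.μ
          + ∫ ω, r (S.iterate η γ k fun n => S.ξ n ω) ∂S.μ := by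
  have hinc : ∀ k, Integrable (fun ω => ‖m (S.iterate η γ k fun n => S.ξ n ω)
        (S.iterate η γ (k + 1) fun n => S.ξ n ω) (S.ξ (k + 1) ω)‖) S.μ ∧
      ∫ ω, ‖m (S.iterate η γ k fun n => S.ξ n ω)
        (S.iterate η γ (k + 1) fun n => S.ξ n ω) (S.ξ (k + 1) ω)‖ ∂S.μ
        ≤ ∫ ω, r (S.iterate η γ k fun n => S.ξ n ω) ∂S.μ := by
    intro k
    have hxm : ∀ k, Measurable fun ω => S.iterate η γ k fun n => S.ξ n ω := fun k =>
      (S.measurable_iterate_estimate η γ fun j _ => S.measurable_ξ j).1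
    have hmm : Measurable fun ω => m (S.iterate η γ k fun n => S.ξ n ω)
        (S.iterate η γ (k + 1) fun n => S.ξ n ω) (S.ξ (k + 1) ω) :=
      hm.comp (((hxm k).prodMk (hxm (k + 1))).prodMk (S.measurable_ξ _))
    refine integrable_and_integral_le_of_lintegral_le hmm.norm.aestronglyMeasurable
      (fun ω => norm_nonneg _) (integral_nonneg fun ω => hr0 _) ?_
    have hFm : Measurable fun p : (EuclideanSpace ℝ (Fin d) × EuclideanSpace ℝ (Fin d)) × Ξ =>
        ENNReal.ofReal ‖m p.1.1 (p.1.1 - γ • (‖p.1.2‖⁻¹ • p.1.2)) p.2‖ := by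
      have h1 : Measurable fun p : (EuclideanSpace ℝ (Fin d) × EuclideanSpace ℝ (Fin d)) × Ξ =>
          m p.1.1 (p.1.1 - γ • (‖p.1.2‖⁻¹ • p.1.2)) p.2 := by
        have h0 : Measurable fun p : (EuclideanSpace ℝ (Fin d) × EuclideanSpace ℝ (Fin d)) × Ξ =>
            ((p.1.1, p.1.1 - γ • (‖p.1.2‖⁻¹ • p.1.2)), p.2) := by fun_prop
        exact hm.comp h0
      exact h1.norm.ennreal_ofReal
    have hxv := S.measurable_iterate_estimate (mΩ' := S.past k) η γ
      (fun j hj => S.measurable_past hj)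
    have hnext := S.lintegral_next (hxv.1.prodMk hxv.2) hFm
    rw [ofReal_integral_eq_lintegral_ofReal (hr k) (Filter.Eventually.of_forall fun ω => hr0 _)]
    refine hnext.trans_le (lintegral_mono fun ω => ?_)
    obtain ⟨h1, h2⟩ := h (S.iterate η γ k fun n => S.ξ n ω) _
      (norm_normalized_step_le hγ _ (S.estimate η γ k fun n => S.ξ n ω))
    dsimp only
    rw [← ofReal_integral_eq_lintegral_ofReal h1
      (Filter.Eventually.of_forall fun _ => norm_nonneg _)]
    exact ENNReal.ofReal_le_ofReal h2
  have hle : ∀ k ω, ‖S.accum η γ a m (fun n => S.ξ n ω) (k + 1)‖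
      ≤ a * ‖S.accum η γ a m (fun n => S.ξ n ω) k‖ + ‖m (S.iterate η γ k fun n => S.ξ n ω)
        (S.iterate η γ (k + 1) fun n => S.ξ n ω) (S.ξ (k + 1) ω)‖ := by
    intro k ω
    refine (norm_add_le _ _).trans_eq ?_
    rw [norm_smul, Real.norm_of_nonneg ha]
  have hint : ∀ k, Integrable (fun ω => ‖S.accum η γ a m (fun n => S.ξ n ω) k‖) S.μ := by
    intro k
    induction k with
    | zero => simp [accum]
    | succ k ih =>
      exact ((ih.const_mul a).add (hinc k).1).mono'
        (S.measurable_accum_ξ η γ a hm (k + 1)).norm.aestronglyMeasurable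
        (Filter.Eventually.of_forall fun ω => by rw [norm_norm]; exact hle k ω)
  refine ⟨hint k, ?_⟩
  refine (integral_mono (hint (k + 1)) (((hint k).const_mul a).add (hinc k).1) (hle k)).trans ?_
  simp only [Pi.add_apply]
  rw [integral_add ((hint k).const_mul a) (hinc k).1, integral_const_mul]
  linarith [(hinc k).2]

end Accum

end StochasticSetup

/-! ### The estimator error and the summed gradient norms. -/

namespace StochasticSetup

variable {d : ℕ} {Ω Ξ : Type*} [MeasurableSpace Ω] [MeasurableSpace Ξ]
  {S : StochasticSetup d Ω Ξ} {η γ A B G : ℝ}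

theorem measurable_gradient (S : StochasticSetup d Ω Ξ) : Measurable (gradient S.f) :=
  (InnerProductSpace.toDual ℝ
    (EuclideanSpace ℝ (Fin d))).symm.continuous.measurable.comp (measurable_fderiv ℝ S.f)

/-- The oracle noise at `y`. -/
noncomputable def noise (S : StochasticSetup d Ω Ξ) (y : EuclideanSpace ℝ (Fin d)) (z : Ξ) :
    EuclideanSpace ℝ (Fin d) :=
  S.g y z - gradient S.f y

/-- The centered oracle difference between `x` and `y`. -/
noncomputable def drift (S : StochasticSetup d Ω Ξ) (x y : EuclideanSpace ℝ (Fin d)) (z : Ξ) :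
    EuclideanSpace ℝ (Fin d) :=
  S.g y z - S.g x z - (gradient S.f y - gradient S.f x)

theorem measurable_noise (S : StochasticSetup d Ω Ξ) :
    Measurable fun p : EuclideanSpace ℝ (Fin d) × Ξ => S.noise p.1 p.2 :=
  S.measurable_g.sub (S.measurable_gradient.comp measurable_fst)

theorem measurable_drift (S : StochasticSetup d Ω Ξ) :
    Measurable fun p : (EuclideanSpace ℝ (Fin d) × EuclideanSpace ℝ (Fin d)) × Ξ =>
      S.drift p.1.1 p.1.2 p.2 := by
  have h1 : Measurable fun p : (EuclideanSpace ℝ (Fin d) × EuclideanSpace ℝ (Fin d)) × Ξ =>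
      (p.1.1, p.2) := by fun_prop
  have h2 : Measurable fun p : (EuclideanSpace ℝ (Fin d) × EuclideanSpace ℝ (Fin d)) × Ξ =>
      (p.1.2, p.2) := by fun_prop
  exact ((S.measurable_g.comp h2).sub (S.measurable_g.comp h1)).sub
    ((S.measurable_gradient.comp (measurable_snd.comp measurable_fst)).sub
      (S.measurable_gradient.comp (measurable_fst.comp measurable_fst)))

theorem BG0Oracle.integrable_noise (h : S.BG0Oracle 0 G) (y : EuclideanSpace ℝ (Fin d)) :
    Integrable (S.noise y) S.P ∧ ∫ z, S.noise y z ∂S.P = 0 := by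
  refine ⟨(h.2.2 y).1.sub (integrable_const _), ?_⟩
  unfold noise
  rw [integral_sub (h.2.2 y).1 (integrable_const _), (h.2.2 y).2.1]
  simp

theorem BG0Oracle.integrable_drift (h : S.BG0Oracle 0 G) (x y : EuclideanSpace ℝ (Fin d)) :
    Integrable (S.drift x y) S.P ∧ ∫ z, S.drift x y z ∂S.P = 0 := by
  have h1 : Integrable (fun z => S.g y z - S.g x z) S.P := (h.2.2 y).1.sub (h.2.2 x).1
  refine ⟨h1.sub (integrable_const _), ?_⟩
  unfold drift
  rw [integral_sub h1 (integrable_const _), integral_sub (h.2.2 y).1 (h.2.2 x).1,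
    (h.2.2 y).2.1, (h.2.2 x).2.1]
  simp

theorem BG0Oracle.memLp_drift (h : S.BG0Oracle 0 G) (x y : EuclideanSpace ℝ (Fin d)) :
    MemLp (S.drift x y) 2 S.P :=
  ((h.memLp y).sub (h.memLp x)).sub (memLp_const _)

theorem BG0Oracle.integral_drift_sq_le (h : S.BG0Oracle 0 G) (x y : EuclideanSpace ℝ (Fin d)) :
    ∫ z, ‖S.drift x y z‖ ^ 2 ∂S.P ≤ ∫ z, ‖S.g y z - S.g x z‖ ^ 2 ∂S.P := by
  have h1 := (integral_norm_sub_integral_sq_le ((h.2.2 y).1.sub (h.2.2 x).1)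
    (((h.memLp y).sub (h.memLp x)).integrable_norm_pow two_ne_zero)).2
  simp only [Pi.sub_apply] at h1
  rw [integral_sub (h.2.2 y).1 (h.2.2 x).1, (h.2.2 y).2.1, (h.2.2 x).2.1] at h1
  exact h1

theorem BG0Oracle.initError_le (h : S.BG0Oracle 0 G) :
    Integrable (fun ω => ‖S.g S.x₀ (S.ξ 0 ω) - gradient S.f S.x₀‖) S.μ ∧
      0 ≤ S.initError ∧ S.initError ≤ G := by
  have h1 := h.memLp_noise S.x₀
  have h2 := (h1.integrable one_le_two).norm
  have h3 := (integral_norm_le_sqrt_integral_norm_sq h1).trans (h.sqrt_noise_le S.x₀)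
  rw [← S.law_ξ 0] at h2 h3
  rw [integral_map (S.measurable_ξ 0).aemeasurable h2.aestronglyMeasurable] at h3
  exact ⟨h2.comp_measurable (S.measurable_ξ 0), integral_nonneg fun ω => norm_nonneg _, h3⟩

/-- The error of the gradient estimator, unrolled; the drift is split with a weight `w`. -/
theorem estimate_sub_gradient (S : StochasticSetup d Ω Ξ) (η γ : ℝ)
    (w : EuclideanSpace ℝ (Fin d) → ℝ) (s : ℕ → Ξ) (k : ℕ) :
    S.estimate η γ k s - gradient S.f (S.iterate η γ k s)
      = (1 - η) ^ k • (S.g S.x₀ (s 0) - gradient S.f S.x₀)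
        + S.accum η γ (1 - η) (fun _ y z => η • S.noise y z) s k
        + S.accum η γ (1 - η) (fun x y z => ((1 - η) * w x) • S.drift x y z) s k
        + S.accum η γ (1 - η) (fun x y z => ((1 - η) * (1 - w x)) • S.drift x y z) s k := by
  induction k with
  | zero => simp [accum, estimate, iterate, nstorm]
  | succ k ih =>
    -- The new error is `(1-η)` times the old one plus `η` times the noise at the new point plus
    -- `(1-η)` times the drift; linearity distributes this over the summands.
    rw [estimate_succ, eq_add_of_sub_eq ih]
    simp only [accum, noise, drift]
    module

/-- The hypotheses on one step of the method: along steps of length at most `γ`, the oracle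
difference is bounded in mean square by an affine function of the gradient norm. -/
def AffineDrift (S : StochasticSetup d Ω Ξ) (γ A B : ℝ) : Prop :=
  ∀ x y, ‖y - x‖ ≤ γ →
    ∫ z, ‖S.g y z - S.g x z‖ ^ 2 ∂S.P ≤ (A + B * ‖gradient S.f x‖) ^ 2

/-- Steps have length at most `γ` whatever the samples, so one step maps a deterministic bound `C`
to `C + A + B C`. This supplies integrability of the gradient norms. -/
theorem AffineDrift.norm_gradient_iterate_le (hd : S.AffineDrift γ A B) (h : S.BG0Oracle 0 G)
    (hγ : 0 ≤ γ) (hA : 0 ≤ A) (hB : 0 ≤ B) (k : ℕ) :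
    ∃ C, ∀ s, ‖gradient S.f (S.iterate η γ k s)‖ ≤ C := by
  induction k with
  | zero => exact ⟨‖gradient S.f S.x₀‖, fun s => le_rfl⟩
  | succ k ih =>
    obtain ⟨C, hC⟩ := ih
    refine ⟨C + (A + B * C), fun s => ?_⟩
    have h1 := h.norm_gradient_sub_le (by positivity)
      (hd _ _ (S.norm_iterate_succ_sub_le η hγ k s))
    have h2 := norm_sub_norm_le (gradient S.f (S.iterate η γ (k + 1) s))
      (gradient S.f (S.iterate η γ k s))
    have h3 := mul_le_mul_of_nonneg_left (hC s) hB
    linarith [hC s]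

theorem measurable_iterate_ξ (S : StochasticSetup d Ω Ξ) (η γ : ℝ) (k : ℕ) :
    Measurable fun ω => S.iterate η γ k fun n => S.ξ n ω :=
  (S.measurable_iterate_estimate η γ fun j _ => S.measurable_ξ j).1

theorem AffineDrift.integrable_gradient_iterate (hd : S.AffineDrift γ A B)
    (h : S.BG0Oracle 0 G) (hγ : 0 ≤ γ) (hA : 0 ≤ A) (hB : 0 ≤ B) (k : ℕ) :
    Integrable (fun ω => ‖gradient S.f (S.iterate η γ k fun n => S.ξ n ω)‖) S.μ := by
  obtain ⟨C, hC⟩ := hd.norm_gradient_iterate_le (η := η) h hγ hA hB k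
  refine Integrable.of_bound
    (S.measurable_gradient.comp (S.measurable_iterate_ξ η γ k)).norm.aestronglyMeasurable C
    (Filter.Eventually.of_forall fun ω => ?_)
  rw [norm_norm]
  exact hC _

/-- The expected gradient norm at the iterate `xᵏ`. -/
noncomputable def expGrad (S : StochasticSetup d Ω Ξ) (η γ : ℝ) (k : ℕ) : ℝ :=
  ∫ ω, ‖gradient S.f (S.iterate η γ k fun n => S.ξ n ω)‖ ∂S.μ

theorem integral_norm_noise_accum_le (h : S.BG0Oracle 0 G) (hη0 : 0 < η) (hη1 : η ≤ 1)
    (hγ : 0 ≤ γ) (k : ℕ) :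
    Integrable (fun ω => ‖S.accum η γ (1 - η) (fun _ y z => η • S.noise y z)
        (fun n => S.ξ n ω) k‖) S.μ ∧
      ∫ ω, ‖S.accum η γ (1 - η) (fun _ y z => η • S.noise y z) (fun n => S.ξ n ω) k‖ ∂S.μ
        ≤ √η * G := by
  have hmeas : Measurable fun p : (EuclideanSpace ℝ (Fin d) × EuclideanSpace ℝ (Fin d)) × Ξ =>
      η • S.noise p.1.2 p.2 := by
    have h2 : Measurable fun p : (EuclideanSpace ℝ (Fin d) × EuclideanSpace ℝ (Fin d)) × Ξ =>
        (p.1.2, p.2) := by fun_prop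
    exact (S.measurable_noise.comp h2).const_smul η
  have hs : √(η * G ^ 2) = √η * G := by rw [Real.sqrt_mul hη0.le, Real.sqrt_sq h.2.1]
  rw [← hs]
  -- The level `M = η G²` is preserved because `(1-η)² + η ≤ 1`.
  refine S.integral_norm_accum_le_sqrt η hγ hmeas (b := η ^ 2 * G ^ 2) (by positivity)
    (by positivity) ?_ (fun x y _ => ?_) k
  · nlinarith [mul_nonneg (mul_nonneg hη0.le (sub_nonneg.2 hη1)) (sq_nonneg G),
      mul_nonneg hη0.le (mul_nonneg (mul_nonneg hη0.le (sub_nonneg.2 hη1)) (sq_nonneg G))]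
  · have h1 := h.integrable_noise y
    have h2 := (h.2.2 y).2.2
    refine ⟨h1.1.smul η, by rw [integral_smul, h1.2, smul_zero], ?_⟩
    simp only [norm_smul, mul_pow, Real.norm_eq_abs, sq_abs, integral_const_mul]
    refine ⟨h2.1.const_mul _, mul_le_mul_of_nonneg_left ?_ (sq_nonneg _)⟩
    simpa [noise] using h2.2

/-- The weight cancels the growth of the drift, leaving second moment `(1-η)² A²` per step. The
level `A² / η` is preserved because `(1-η)²(1+η) ≤ 1`. -/
theorem AffineDrift.integral_norm_drift_accum_le (hd : S.AffineDrift γ A B)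
    (h : S.BG0Oracle 0 G) (hη0 : 0 < η) (hη1 : η ≤ 1) (hγ : 0 ≤ γ) (hA : 0 < A) (hB : 0 ≤ B)
    (k : ℕ) :
    Integrable (fun ω => ‖S.accum η γ (1 - η) (fun x y z =>
        ((1 - η) * (A / (A + B * ‖gradient S.f x‖))) • S.drift x y z) (fun n => S.ξ n ω) k‖) S.μ ∧
      ∫ ω, ‖S.accum η γ (1 - η) (fun x y z =>
        ((1 - η) * (A / (A + B * ‖gradient S.f x‖))) • S.drift x y z) (fun n => S.ξ n ω) k‖ ∂S.μ
        ≤ A / √η := by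
  have hmeas : Measurable fun p : (EuclideanSpace ℝ (Fin d) × EuclideanSpace ℝ (Fin d)) × Ξ =>
      ((1 - η) * (A / (A + B * ‖gradient S.f p.1.1‖))) • S.drift p.1.1 p.1.2 p.2 := by
    have h1 : Measurable fun p : (EuclideanSpace ℝ (Fin d) × EuclideanSpace ℝ (Fin d)) × Ξ =>
        ‖gradient S.f p.1.1‖ :=
      (S.measurable_gradient.comp (measurable_fst.comp measurable_fst)).norm
    exact (((h1.const_mul B).const_add A).const_div A |>.const_mul (1 - η)).smul S.measurable_drift
  have hs : √(A ^ 2 / η) = A / √η := by rw [Real.sqrt_div (sq_nonneg A), Real.sqrt_sq hA.le]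
  rw [← hs]
  refine S.integral_norm_accum_le_sqrt η hγ hmeas (b := (1 - η) ^ 2 * A ^ 2) (by positivity)
    (by positivity) ?_ (fun x y hxy => ?_) k
  · have h1 : (1 - η) ^ 2 * (A ^ 2 / η) + (1 - η) ^ 2 * A ^ 2
        = (1 - η) ^ 2 * (1 + η) * (A ^ 2 / η) := by field_simp
    rw [h1]
    refine mul_le_of_le_one_left (by positivity) ?_
    nlinarith [mul_nonneg hη0.le hη0.le, mul_nonneg (mul_nonneg hη0.le hη0.le) (sub_nonneg.2 hη1)]
  · have h1 := h.integrable_drift x y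
    have h2 := (h.memLp_drift x y).integrable_norm_pow two_ne_zero
    refine ⟨h1.1.smul ((1 - η) * (A / (A + B * ‖gradient S.f x‖))), by rw [integral_smul, h1.2, smul_zero], ?_⟩
    simp only [norm_smul, mul_pow, Real.norm_eq_abs, sq_abs, integral_const_mul]
    refine ⟨h2.const_mul _, ?_⟩
    have h3 := (h.integral_drift_sq_le x y).trans (hd x y hxy)
    have h4 : 0 < A + B * ‖gradient S.f x‖ := by positivity
    calc (1 - η) ^ 2 * (A / (A + B * ‖gradient S.f x‖)) ^ 2 * ∫ z, ‖S.drift x y z‖ ^ 2 ∂S.P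
        ≤ (1 - η) ^ 2 * (A / (A + B * ‖gradient S.f x‖)) ^ 2 * (A + B * ‖gradient S.f x‖) ^ 2 := by
          gcongr
      _ = (1 - η) ^ 2 * A ^ 2 := by field_simp

/-- The complementary weight `B‖∇f(x)‖ / (A + B‖∇f(x)‖)` times the L² bound of the drift is exactly
`B‖∇f(x)‖`, linear in the gradient norm and hence absorbable after summation. -/
theorem AffineDrift.integral_norm_rest_accum_succ_le (hd : S.AffineDrift γ A B)
    (h : S.BG0Oracle 0 G) (hη1 : η ≤ 1) (hγ : 0 ≤ γ) (hA : 0 < A) (hB : 0 ≤ B) (k : ℕ) :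
    Integrable (fun ω => ‖S.accum η γ (1 - η) (fun x y z =>
        ((1 - η) * (1 - A / (A + B * ‖gradient S.f x‖))) • S.drift x y z)
        (fun n => S.ξ n ω) k‖) S.μ ∧
      ∫ ω, ‖S.accum η γ (1 - η) (fun x y z =>
        ((1 - η) * (1 - A / (A + B * ‖gradient S.f x‖))) • S.drift x y z)
        (fun n => S.ξ n ω) (k + 1)‖ ∂S.μ
      ≤ (1 - η) * ∫ ω, ‖S.accum η γ (1 - η) (fun x y z =>
        ((1 - η) * (1 - A / (A + B * ‖gradient S.f x‖))) • S.drift x y z)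
        (fun n => S.ξ n ω) k‖ ∂S.μ + (1 - η) * (B * S.expGrad η γ k) := by
  have hη : 0 ≤ 1 - η := sub_nonneg.2 hη1
  have hmeas : Measurable fun p : (EuclideanSpace ℝ (Fin d) × EuclideanSpace ℝ (Fin d)) × Ξ =>
      ((1 - η) * (1 - A / (A + B * ‖gradient S.f p.1.1‖))) • S.drift p.1.1 p.1.2 p.2 := by
    have h1 : Measurable fun p : (EuclideanSpace ℝ (Fin d) × EuclideanSpace ℝ (Fin d)) × Ξ =>
        ‖gradient S.f p.1.1‖ :=
      (S.measurable_gradient.comp (measurable_fst.comp measurable_fst)).norm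
    exact ((((h1.const_mul B).const_add A).const_div A).const_sub 1
      |>.const_mul (1 - η)).smul S.measurable_drift
  have h0 := S.integral_norm_accum_succ_le (m := fun x y z =>
      ((1 - η) * (1 - A / (A + B * ‖gradient S.f x‖))) • S.drift x y z) η hγ hη hmeas
    (r := fun x => (1 - η) * (B * ‖gradient S.f x‖)) (fun x => by positivity)
    (fun k => ((hd.integrable_gradient_iterate h hγ hA.le hB k).const_mul B).const_mul (1 - η))
    (fun x y hxy => ?_) k
  · simpa only [integral_const_mul, expGrad] using h0
  · have h1 := h.memLp_drift x y
    have h4 : 0 < A + B * ‖gradient S.f x‖ := by positivity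
    have h5 : 0 ≤ (1 - η) * (1 - A / (A + B * ‖gradient S.f x‖)) := by
      refine mul_nonneg hη (sub_nonneg.2 (div_le_one_of_le₀ ?_ h4.le))
      have : 0 ≤ B * ‖gradient S.f x‖ := by positivity
      linarith
    simp only [norm_smul, Real.norm_of_nonneg h5, integral_const_mul]
    refine ⟨(h1.integrable one_le_two).norm.const_mul _, ?_⟩
    have h2 : ∫ z, ‖S.drift x y z‖ ∂S.P ≤ A + B * ‖gradient S.f x‖ :=
      (integral_norm_le_sqrt_integral_norm_sq h1).trans
        ((Real.sqrt_le_left h4.le).2 ((h.integral_drift_sq_le x y).trans (hd x y hxy)))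
    refine (mul_le_mul_of_nonneg_left h2 h5).trans_eq ?_
    field_simp
    ring

theorem sum_le_of_contraction {η : ℝ} {ρ n : ℕ → ℝ} (hρ : ∀ k, 0 ≤ ρ k)
    (hn : ∀ k, 0 ≤ n k) (h0 : ρ 0 = 0) (h : ∀ k, ρ (k + 1) ≤ (1 - η) * ρ k + (1 - η) * n k)
    (hη0 : 0 ≤ η) (T : ℕ) :
    η * ∑ k ∈ Finset.range T, ρ k ≤ ∑ k ∈ Finset.range T, n k := by
  -- Keeping the last term `ρ T` makes the induction close.
  suffices η * ∑ k ∈ Finset.range T, ρ k + ρ T ≤ ∑ k ∈ Finset.range T, n k by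
    linarith [hρ T]
  induction T with
  | zero => simp [h0]
  | succ T ih =>
    rw [Finset.sum_range_succ, Finset.sum_range_succ]
    nlinarith [h T, hn T]

theorem integral_le_of_le_add_four {Ω : Type*} [MeasurableSpace Ω] {μ : Measure Ω}
    {F a b c e : Ω → ℝ} (hF : Integrable F μ) (ha : Integrable a μ) (hb : Integrable b μ)
    (hc : Integrable c μ) (he : Integrable e μ) (hle : ∀ ω, F ω ≤ a ω + b ω + c ω + e ω) :
    ∫ ω, F ω ∂μ ≤ ∫ ω, a ω ∂μ + ∫ ω, b ω ∂μ + ∫ ω, c ω ∂μ + ∫ ω, e ω ∂μ := by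
  have h := integral_mono hF (((ha.add hb).add hc).add he) hle
  rwa [integral_add' ((ha.add hb).add hc) he, integral_add' (ha.add hb) hc,
    integral_add' ha hb] at h

/-- The sum of the expected estimation errors. -/
theorem AffineDrift.sum_integral_norm_error_le (hd : S.AffineDrift γ A B)
    (h : S.BG0Oracle 0 G) (hη0 : 0 < η) (hη1 : η ≤ 1) (hγ : 0 ≤ γ) (hA : 0 < A) (hB : 0 ≤ B) :
    (∀ k, Integrable (fun ω => ‖S.estimate η γ k (fun n => S.ξ n ω)
        - gradient S.f (S.iterate η γ k fun n => S.ξ n ω)‖) S.μ) ∧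
      ∀ T : ℕ, ∑ k ∈ Finset.range T, ∫ ω, ‖S.estimate η γ k (fun n => S.ξ n ω)
        - gradient S.f (S.iterate η γ k fun n => S.ξ n ω)‖ ∂S.μ
      ≤ S.initError / η + T * (√η * G + A / √η)
        + B / η * ∑ k ∈ Finset.range T, S.expGrad η γ k := by
  set w : EuclideanSpace ℝ (Fin d) → ℝ := fun x => A / (A + B * ‖gradient S.f x‖) with hw
  have hη : 0 ≤ 1 - η := sub_nonneg.2 hη1
  set ρ : ℕ → ℝ := fun k => ∫ ω, ‖S.accum η γ (1 - η) (fun x y z =>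
    ((1 - η) * (1 - w x)) • S.drift x y z) (fun n => S.ξ n ω) k‖ ∂S.μ with hρ
  have hP := integral_norm_noise_accum_le h hη0 hη1 hγ
  have hQ := hd.integral_norm_drift_accum_le h hη0 hη1 hγ hA hB
  have hR := hd.integral_norm_rest_accum_succ_le h hη1 hγ hA hB
  obtain ⟨hI, hb0, -⟩ := h.initError_le
  have hsum : ∀ k, Integrable (fun ω => (1 - η) ^ k * ‖S.g S.x₀ (S.ξ 0 ω) - gradient S.f S.x₀‖
        + ‖S.accum η γ (1 - η) (fun _ y z => η • S.noise y z) (fun n => S.ξ n ω) k‖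
        + ‖S.accum η γ (1 - η) (fun x y z => ((1 - η) * w x) • S.drift x y z)
          (fun n => S.ξ n ω) k‖
        + ‖S.accum η γ (1 - η) (fun x y z => ((1 - η) * (1 - w x)) • S.drift x y z)
          (fun n => S.ξ n ω) k‖) S.μ :=
    fun k => (((hI.const_mul _).add (hP k).1).add (hQ k).1).add (hR k).1
  have hle : ∀ k ω, ‖S.estimate η γ k (fun n => S.ξ n ω)
      - gradient S.f (S.iterate η γ k fun n => S.ξ n ω)‖
      ≤ (1 - η) ^ k * ‖S.g S.x₀ (S.ξ 0 ω) - gradient S.f S.x₀‖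
        + ‖S.accum η γ (1 - η) (fun _ y z => η • S.noise y z) (fun n => S.ξ n ω) k‖
        + ‖S.accum η γ (1 - η) (fun x y z => ((1 - η) * w x) • S.drift x y z)
          (fun n => S.ξ n ω) k‖
        + ‖S.accum η γ (1 - η) (fun x y z => ((1 - η) * (1 - w x)) • S.drift x y z)
          (fun n => S.ξ n ω) k‖ := by
    intro k ω
    rw [S.estimate_sub_gradient η γ w]
    refine (norm_add₄_le).trans_eq ?_
    rw [norm_smul, Real.norm_of_nonneg (pow_nonneg hη k)]
  have hint : ∀ k, Integrable (fun ω => ‖S.estimate η γ k (fun n => S.ξ n ω)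
      - gradient S.f (S.iterate η γ k fun n => S.ξ n ω)‖) S.μ := by
    intro k
    have hm := S.measurable_iterate_estimate (k := k) η γ fun j _ => S.measurable_ξ j
    refine (hsum k).mono'
      (hm.2.sub (S.measurable_gradient.comp hm.1)).norm.aestronglyMeasurable
      (Filter.Eventually.of_forall fun ω => ?_)
    rw [norm_norm]
    exact hle k ω
  refine ⟨hint, fun T => ?_⟩
  have hE : ∀ k, ∫ ω, ‖S.estimate η γ k (fun n => S.ξ n ω)
      - gradient S.f (S.iterate η γ k fun n => S.ξ n ω)‖ ∂S.μ
      ≤ S.initError * (1 - η) ^ k + (√η * G + A / √η) + ρ k := by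
    intro k
    have h1 := integral_le_of_le_add_four (hint k) (hI.const_mul ((1 - η) ^ k)) (hP k).1 (hQ k).1
      (hR k).1 (hle k)
    rw [integral_const_mul] at h1
    have h2 := (hP k).2
    have h3 := (hQ k).2
    simp only [initError, hρ]
    linarith
  have hgeom : ∑ k ∈ Finset.range T, (1 - η) ^ k ≤ 1 / η := by
    rw [le_div_iff₀ hη0]
    have h1 := geom_sum_mul (1 - η) T
    have h2 := pow_nonneg hη T
    linarith
  have hcontr := sum_le_of_contraction (ρ := ρ) (n := fun k => B * S.expGrad η γ k)
    (fun k => integral_nonneg fun ω => norm_nonneg _)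
    (fun k => mul_nonneg hB (integral_nonneg fun ω => norm_nonneg _))
    (by simp [hρ, accum]) (fun k => (hR k).2) hη0.le T
  rw [← Finset.mul_sum] at hcontr
  have hcontr' : ∑ k ∈ Finset.range T, ρ k ≤ B / η * ∑ k ∈ Finset.range T, S.expGrad η γ k := by
    rw [div_mul_eq_mul_div, le_div_iff₀ hη0]
    linarith
  refine (Finset.sum_le_sum fun k _ => hE k).trans ?_
  rw [Finset.sum_add_distrib, Finset.sum_add_distrib, ← Finset.mul_sum, Finset.sum_const,
    Finset.card_range, nsmul_eq_mul]
  have h5 := mul_le_mul_of_nonneg_left hgeom hb0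
  rw [mul_one_div] at h5
  linarith

/-- The sum of the expected gradient norms along a run. -/
theorem AffineDrift.sum_expGrad_le (hd : S.AffineDrift γ A B) (hlow : S.LowerBounded)
    (h : S.BG0Oracle 0 G) (hη0 : 0 < η) (hη1 : η ≤ 1) (hγ : 0 < γ) (hA : 0 < A) (hB : 0 ≤ B)
    {D : ℝ} (hdesc : ∀ x y, ‖y - x‖ ≤ γ →
      S.f y ≤ S.f x + ⟪gradient S.f x, y - x⟫ + γ * (D + B * ‖gradient S.f x‖)) (T : ℕ) :
    (1 - 2 * (B / η) - B) * ∑ k ∈ Finset.range T, S.expGrad η γ k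
      ≤ S.gap / γ + 2 * (S.initError / η) + T * (2 * (√η * G) + 2 * (A / √η) + D) := by
  obtain ⟨hint, herr⟩ := hd.sum_integral_norm_error_le h hη0 hη1 hγ.le hA hB
  have hN := fun k => hd.integrable_gradient_iterate (η := η) h hγ.le hA.le hB k
  -- Pathwise descent: normalization contributes `-‖∇f‖ + 2‖e‖`, and the remainder contributes `D +
  -- B‖∇f‖`, whose slope moves to the left.
  have hstep : ∀ k (s : ℕ → Ξ), γ * ((1 - B) * ‖gradient S.f (S.iterate η γ k s)‖)
      ≤ S.f (S.iterate η γ k s) - S.f (S.iterate η γ (k + 1) s)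
        + γ * (2 * ‖S.estimate η γ k s - gradient S.f (S.iterate η γ k s)‖ + D) := by
    intro k s
    have h1 := hdesc _ _ (S.norm_iterate_succ_sub_le η hγ.le k s)
    have h2 := inner_neg_normalized_le (gradient S.f (S.iterate η γ k s)) (S.estimate η γ k s)
    have h3 : S.iterate η γ (k + 1) s - S.iterate η γ k s
        = γ • -(‖S.estimate η γ k s‖⁻¹ • S.estimate η γ k s) := by
      rw [iterate_succ, sub_sub_cancel_left, smul_neg]
    rw [h3, real_inner_smul_right] at h1
    have h4 := mul_le_mul_of_nonneg_left h2 hγ.le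
    linarith
  have hpt : ∀ s : ℕ → Ξ, ∑ k ∈ Finset.range T, (1 - B) * ‖gradient S.f (S.iterate η γ k s)‖
      ≤ S.gap / γ + ∑ k ∈ Finset.range T,
        (2 * ‖S.estimate η γ k s - gradient S.f (S.iterate η γ k s)‖ + D) := by
    intro s
    have h1 := Finset.sum_le_sum fun k (_ : k ∈ Finset.range T) => hstep k s
    rw [Finset.sum_add_distrib, Finset.sum_range_sub' (fun k => S.f (S.iterate η γ k s))] at h1
    have h2 : S.f (S.iterate η γ 0 s) - S.f (S.iterate η γ T s) ≤ S.gap :=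
      sub_le_sub_left (ciInf_le hlow _) _
    have h3 : γ * (S.gap / γ) = S.gap := mul_div_cancel₀ _ hγ.ne'
    refine le_of_mul_le_mul_left ?_ hγ
    rw [mul_add, h3, Finset.mul_sum, Finset.mul_sum]
    linarith
  have hk : ∀ k, Integrable (fun ω => 2 * ‖S.estimate η γ k (fun n => S.ξ n ω)
      - gradient S.f (S.iterate η γ k fun n => S.ξ n ω)‖ + D) S.μ :=
    fun k => ((hint k).const_mul 2).add (integrable_const D)
  have hks := integrable_finsetSum (Finset.range T) fun k _ => hk k
  have h1 := integral_mono
    (integrable_finsetSum (Finset.range T) fun k _ => (hN k).const_mul (1 - B))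
    ((integrable_const (S.gap / γ)).add hks) (fun ω => hpt fun n => S.ξ n ω)
  simp only [Pi.add_apply] at h1
  rw [integral_add (integrable_const _) hks,
    integral_finsetSum _ fun k _ => (hN k).const_mul (1 - B),
    integral_finsetSum _ fun k _ => hk k] at h1
  have h2 : ∀ k, ∫ ω, (2 * ‖S.estimate η γ k (fun n => S.ξ n ω)
      - gradient S.f (S.iterate η γ k fun n => S.ξ n ω)‖ + D) ∂S.μ
      = 2 * ∫ ω, ‖S.estimate η γ k (fun n => S.ξ n ω)
      - gradient S.f (S.iterate η γ k fun n => S.ξ n ω)‖ ∂S.μ + D := by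
    intro k
    rw [integral_add ((hint k).const_mul 2) (integrable_const D), integral_const_mul]
    simp
  simp only [h2, integral_const_mul, integral_const, probReal_univ, one_smul] at h1
  rw [← Finset.mul_sum, Finset.sum_add_distrib, ← Finset.mul_sum, Finset.sum_const,
    Finset.card_range, nsmul_eq_mul] at h1
  have h3 := herr T
  simp only [expGrad] at h3 ⊢
  linarith

end StochasticSetup

/-! ### Query counts and comparison of rates. -/

/-- The complexity constant obtained from a rate `C T^(-1/3)`. -/
noncomputable def complexityConstant (C : ℝ) : ℝ := 2 * max C 0 ^ 3 + max C 0 + 5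

/-- A horizon at which a rate `C T^(-1/3)` reaches the accuracy `ε`. -/
noncomputable def complexityHorizon (C ε : ℝ) : ℕ := ⌈(max C 0 / ε) ^ 3⌉₊

theorem length_queries_nstorm {d : ℕ} {Ξ : Type*}
    (g : EuclideanSpace ℝ (Fin d) → Ξ → EuclideanSpace ℝ (Fin d))
    (x₀ : EuclideanSpace ℝ (Fin d)) (η γ : ℝ) (s : ℕ → Ξ) (k : ℕ) :
    (nstorm g x₀ η γ s k).queries.length = 2 * k + 1 := by
  induction k with
  | zero => simp [nstorm]
  | succ k ih => simp [nstorm, ih]; ring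

section Rates

theorem bvSchedule_eq (c : ℝ) (K : ℕ) :
    bvSchedule c K = c * (((K : ℝ) + 1) ^ (-(1 / 3) : ℝ)) ^ 2 := by
  rw [bvSchedule, ← Real.rpow_natCast, ← Real.rpow_mul (by positivity)]
  norm_num

theorem rpow_neg_two_thirds {T : ℝ} (hT : 0 ≤ T) :
    T ^ (-(2 / 3) : ℝ) = (T ^ (-(1 / 3) : ℝ)) ^ 2 := by
  rw [← Real.rpow_natCast, ← Real.rpow_mul hT]
  norm_num

theorem mul_rpow_neg_third_pow_three {T : ℝ} (hT : 0 < T) :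
    T * (T ^ (-(1 / 3) : ℝ)) ^ 3 = 1 := by
  rw [← Real.rpow_natCast, ← Real.rpow_mul hT.le]
  norm_num
  rw [Real.rpow_neg_one, mul_inv_cancel₀ hT.ne']

theorem rpow_neg_third_le_one {T : ℝ} (hT : 1 ≤ T) : T ^ (-(1 / 3) : ℝ) ≤ 1 :=
  Real.rpow_le_one_of_one_le_of_nonpos hT (by norm_num)

theorem rpow_le_rpow_neg_third {T a : ℝ} (hT : 1 ≤ T) (ha : a ≤ -(1 / 3)) :
    T ^ a ≤ T ^ (-(1 / 3) : ℝ) :=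
  Real.rpow_le_rpow_of_exponent_le hT ha

variable {Δ Δ₀ b G L L₀ L₁ η₀ γ₀ T : ℝ}

/-- For `T ≥ 1` every power present is at most `T^(-1/3)`, so the coefficients add up to the bound
at `T = 1`. Replacing `Δ` and `b₀` by `Δ₀` and `G` frees the constant from the particular problem.
-/
theorem bvBoundMSS_le (hL : 0 ≤ L) (hη : 0 < η₀) (hγ : 0 < γ₀)
    (hΔ : Δ ≤ Δ₀) (hb : b ≤ G) (hT : 1 ≤ T) :
    bvBoundMSS Δ b G L η₀ γ₀ T ≤ bvBoundMSS Δ₀ G G L η₀ γ₀ 1 * T ^ (-(1 / 3) : ℝ) := by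
  have h1 := rpow_le_rpow_neg_third (a := -(2 / 3)) hT (by norm_num)
  have h0 : 0 ≤ T ^ (-(1 / 3) : ℝ) := by positivity
  simp only [bvBoundMSS, Real.one_rpow, mul_one, add_mul _ (L * γ₀ / 2)]
  gcongr

theorem bvBoundAlpha_le {α lam₀ : ℝ} (hα : 0 < α) (hα1 : α < 1) (hL₀ : 0 < L₀) (hL₁ : 0 < L₁)
    (hη : 0 < η₀) (hγ : 0 < γ₀) (hl : 0 < lam₀) (hG : 0 ≤ G)
    (hΔ : Δ ≤ Δ₀) (hb : b ≤ G) (hT : 1 ≤ T) :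
    bvBoundAlpha α Δ b G L₀ L₁ η₀ γ₀ lam₀ T
      ≤ bvBoundAlpha α Δ₀ G G L₀ L₁ η₀ γ₀ lam₀ 1 * T ^ (-(1 / 3) : ℝ) := by
  have hp := symp_pos hα hα1
  have hK₀ := symK₀_pos (α := α) hL₀
  have hK₂ := symK₂_pos (α := α) hL₁
  have hLα := symLα_pos (α := α) hL₁
  have hc := symc_nonneg hα hα1
  have h1 := rpow_le_rpow_neg_third (a := -(2 / 3)) hT (by norm_num)
  have h2 := rpow_le_rpow_neg_third (a := -((1 + 2 * symp α) / 3)) hT (by linarith)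
  have h3 := rpow_le_rpow_neg_third (a := -(2 * (symp α + 1) / 3)) hT (by linarith)
  have h0 : 0 ≤ T ^ (-(1 / 3) : ℝ) := by positivity
  simp only [bvBoundAlpha, Real.one_rpow, mul_one]
  rw [add_mul _ (2 * symLα α L₁ * G ^ α * γ₀),
    add_mul _ (4 * symK₂ α L₁ * γ₀ ^ (symp α + 1)),
    add_mul _ (2 * γ₀ * (symK₀ α L₀ + symc α * symLα α L₁ * lam₀ ^ (-symp α))),
    add_mul _ (8 * symK₂ α L₁ * γ₀ ^ (symp α + 1) / √η₀)]
  gcongr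

theorem bvBoundOne_le (hL₀ : 0 < L₀) (hL₁ : 0 < L₁) (hη : 0 < η₀) (hγ : 0 < γ₀) (hG : 0 ≤ G)
    (hΔ : Δ ≤ Δ₀) (hb : b ≤ G) (hT : 1 ≤ T) :
    bvBoundOne Δ b G L₀ L₁ η₀ γ₀ T ≤ bvBoundOne Δ₀ G G L₀ L₁ η₀ γ₀ 1 * T ^ (-(1 / 3) : ℝ) := by
  have h1 := rpow_le_rpow_neg_third (a := -(2 / 3)) hT (by norm_num)
  have h0 : 0 ≤ T ^ (-(1 / 3) : ℝ) := by positivity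
  simp only [bvBoundOne, Real.one_rpow, mul_one]
  rw [add_mul _ (4 * √2 * L₀ * γ₀ + 8 * √2 * L₁ * G * γ₀)]
  gcongr

end Rates

/-! ### From summed gradients to the output, and the three cases. -/

namespace StochasticSetup

variable {d : ℕ} {Ω Ξ : Type*} [MeasurableSpace Ω] [MeasurableSpace Ξ]
  {S : StochasticSetup d Ω Ξ} {η γ η₀ γ₀ A B G : ℝ}

theorem ExpGradNormLE.mono {K : ℕ} {r r' : ℝ} (h : S.ExpGradNormLE η γ K r) (hr : r ≤ r') :
    S.ExpGradNormLE η γ K r' :=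
  ⟨h.1, h.2.trans hr⟩

/-- The expected gradient norm at the output is the average over the run. -/
theorem expGradNormLE_of_sum_le (K : ℕ)
    (hN : ∀ k, Integrable (fun ω => ‖gradient S.f (S.iterate η γ k fun n => S.ξ n ω)‖) S.μ)
    {r : ℝ} (hr : ∑ k ∈ Finset.range (K + 1), S.expGrad η γ k ≤ ((K : ℝ) + 1) * r) :
    S.ExpGradNormLE η γ K r := by
  have hψ : ∀ k, Measurable fun s : ℕ → Ξ => ‖gradient S.f (S.iterate η γ k s)‖ := fun k =>
    (S.measurable_gradient.comp (S.measurable_iterate_estimate (k := k)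
      (ζ := fun j (s : ℕ → Ξ) => s j) η γ fun j _ => measurable_pi_apply j).1).norm
  have hφ : ∀ i : Fin (K + 1), Measurable fun j : Fin (K + 1) => if j = i then (1 : ℝ) else 0 :=
    fun i => measurable_of_countable _
  -- The output is expanded over the indicators of the selected index, which are independent of the
  -- iterates as functions of the whole sample sequence.
  have hind := fun i : Fin (K + 1) => (S.indep_κ K).comp (hφ i) (hψ i)
  have hI : ∀ i : Fin (K + 1), Integrable (fun ω => if S.κ K ω = i then (1 : ℝ) else 0) S.μ :=
    fun i => Integrable.of_bound
      ((hφ i).comp (S.measurable_κ K)).aestronglyMeasurable 1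
      (Filter.Eventually.of_forall fun ω => by split_ifs <;> simp)
  have hprod : ∀ i : Fin (K + 1), Integrable (fun ω => (if S.κ K ω = i then (1 : ℝ) else 0)
      * ‖gradient S.f (S.iterate η γ i fun n => S.ξ n ω)‖) S.μ :=
    fun i => (hind i).integrable_mul (hI i) (hN i)
  have hval : ∀ i : Fin (K + 1), ∫ ω, (if S.κ K ω = i then (1 : ℝ) else 0)
      * ‖gradient S.f (S.iterate η γ i fun n => S.ξ n ω)‖ ∂S.μ
      = 1 / ((K : ℝ) + 1) * S.expGrad η γ i := by
    intro i
    have h1 := (hind i).integral_fun_mul_eq_mul_integral (hI i).aestronglyMeasurable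
      (hN i).aestronglyMeasurable
    refine h1.trans ?_
    congr 1
    have hmeas : MeasurableSet {ω | S.κ K ω = i} := S.measurable_κ K (measurableSet_singleton i)
    rw [← S.uniform_κ K i, ← integral_indicator_one hmeas]
    exact integral_congr_ae (Filter.Eventually.of_forall fun ω => by
      simp [Set.indicator_apply])
  have hout : ∀ ω, ‖gradient S.f (S.output η γ K ω)‖ = ∑ i : Fin (K + 1),
      (if S.κ K ω = i then (1 : ℝ) else 0)
        * ‖gradient S.f (S.iterate η γ i fun n => S.ξ n ω)‖ := by
    intro ω
    simp [output, state, iterate]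
  unfold ExpGradNormLE
  simp only [hout]
  refine ⟨integrable_finsetSum _ fun i _ => hprod i, ?_⟩
  rw [integral_finsetSum _ fun i _ => hprod i]
  simp only [hval]
  rw [← Finset.mul_sum, Fin.sum_univ_eq_sum_range (fun k => S.expGrad η γ k), one_div,
    inv_mul_le_iff₀ (by positivity)]
  exact hr

theorem AffineDrift.descent (hd : S.AffineDrift γ A B) (h : S.BG0Oracle 0 G) (hA : 0 ≤ A)
    (hB : 0 ≤ B) (x y : EuclideanSpace ℝ (Fin d)) (hxy : ‖y - x‖ ≤ γ) :
    S.f y ≤ S.f x + ⟪gradient S.f x, y - x⟫ + γ * (A + B * ‖gradient S.f x‖) :=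
  le_add_inner_gradient_add S.differentiable_f
    (fun w hw => h.norm_gradient_sub_le (by positivity) (hd x w hw)) hxy

theorem gap_nonneg (hlow : S.LowerBounded) : 0 ≤ S.gap :=
  sub_nonneg.2 (ciInf_le hlow _)

/-- The rate of a run of horizon `K` with the scheduled parameters. -/
theorem AffineDrift.expGradNormLE {K : ℕ} {D c : ℝ}
    (hd : S.AffineDrift (bvSchedule γ₀ K) A B) (hlow : S.LowerBounded) (h : S.BG0Oracle 0 G)
    (hη0 : 0 < η₀) (hη1 : η₀ ≤ 1) (hγ : 0 < γ₀) (hA : 0 < A) (hB : 0 ≤ B)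
    (hdesc : ∀ x y, ‖y - x‖ ≤ bvSchedule γ₀ K → S.f y ≤ S.f x + ⟪gradient S.f x, y - x⟫
      + bvSchedule γ₀ K * (D + B * ‖gradient S.f x‖))
    (hc0 : 0 ≤ c) (hc : 1 ≤ c * (1 - 2 * (B / bvSchedule η₀ K) - B)) :
    S.ExpGradNormLE (bvSchedule η₀ K) (bvSchedule γ₀ K) K
      (c * ((S.gap / γ₀ + 2 * (S.initError / η₀) + 2 * (√η₀ * G)) * ((K : ℝ) + 1) ^ (-(1 / 3) : ℝ)
        + 2 * (A / (√η₀ * ((K : ℝ) + 1) ^ (-(1 / 3) : ℝ))) + D)) := by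
  have hT : (0 : ℝ) < (K : ℝ) + 1 := by positivity
  have hT1 : (1 : ℝ) ≤ (K : ℝ) + 1 := by simp
  have hq3 := mul_rpow_neg_third_pow_three hT
  have hq1 := rpow_neg_third_le_one hT1
  have hη := bvSchedule_eq η₀ K
  have hγe := bvSchedule_eq γ₀ K
  have hq0 : 0 < ((K : ℝ) + 1) ^ (-(1 / 3) : ℝ) := by positivity
  set q := ((K : ℝ) + 1) ^ (-(1 / 3) : ℝ) with hq
  have hηpos : 0 < bvSchedule η₀ K := by rw [hη]; positivity
  have hγpos : 0 < bvSchedule γ₀ K := by rw [hγe]; positivity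
  have hηle : bvSchedule η₀ K ≤ 1 := by
    rw [hη]; exact mul_le_one₀ hη1 (sq_nonneg _) (pow_le_one₀ hq0.le hq1)
  have hN := fun k => hd.integrable_gradient_iterate (η := bvSchedule η₀ K) h hγpos.le hA.le hB k
  refine expGradNormLE_of_sum_le K hN ?_
  have h1 := hd.sum_expGrad_le hlow h hηpos hηle hγpos hA hB hdesc (K + 1)
  have hsqrt : √(bvSchedule η₀ K) = √η₀ * q := by
    rw [hη, Real.sqrt_mul hη0.le, Real.sqrt_sq hq0.le]
  have hS : 0 ≤ ∑ k ∈ Finset.range (K + 1), S.expGrad (bvSchedule η₀ K) (bvSchedule γ₀ K) k :=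
    Finset.sum_nonneg fun k _ => integral_nonneg fun ω => norm_nonneg _
  -- Since `T q³ = 1`, dividing by a schedule `b q²` is the same as multiplying by `T q / b`; the
  -- factor `T` is then removed by averaging.
  have hdiv : ∀ a b : ℝ, b ≠ 0 → a / (b * q ^ 2) = ((K : ℝ) + 1) * (a / b * q) := by
    intro a b hb
    field_simp
    linear_combination (-a) * hq3
  have h2 := mul_le_mul_of_nonneg_left h1 hc0
  have h3 := mul_le_mul_of_nonneg_right hc hS
  rw [hsqrt, hγe, hη, hdiv S.gap γ₀ hγ.ne', hdiv S.initError η₀ hη0.ne'] at h2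
  rw [hη, hγe] at h3
  rw [hη, hγe]
  push_cast at h2
  linarith

/-- A rate `T^(-1/3)` with a uniform constant gives cubic complexity. -/
theorem cubicComplexity_of_rate {C : ℝ} (hC : 0 ≤ C)
    (h : ∀ K : ℕ, S.ExpGradNormLE (bvSchedule η₀ K) (bvSchedule γ₀ K) K
      (C * ((K : ℝ) + 1) ^ (-(1 / 3) : ℝ))) :
    S.CubicComplexity η₀ γ₀ (2 * C ^ 3 + C + 5) fun ε => ⌈(C / ε) ^ 3⌉₊ := by
  have hC3 : 0 ≤ C ^ 3 := by positivity
  refine ⟨fun K => (h K).mono ?_, fun ε hε hε1 => ⟨fun ω => ?_, (h _).mono ?_⟩⟩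
  · gcongr
    linarith
  · have h1 : S.sfoCalls (bvSchedule η₀ ⌈(C / ε) ^ 3⌉₊) (bvSchedule γ₀ ⌈(C / ε) ^ 3⌉₊)
        ⌈(C / ε) ^ 3⌉₊ ω = 2 * (⌈(C / ε) ^ 3⌉₊ + 1) + 1 := length_queries_nstorm _ _ _ _ _ _
    rw [h1]
    push_cast
    -- A run makes `2K + 3` queries and the ceiling adds at most 1 to the horizon, whence `2(C/ε)³ +
    -- 5`; the 5 is absorbed using `ε ≤ 1`.
    have h2 := (Nat.ceil_lt_add_one (a := (C / ε) ^ 3) (by positivity)).le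
    have h3 : (C / ε) ^ 3 * ε ^ 3 = C ^ 3 := by field_simp
    have h4 : ε ^ 3 ≤ 1 := pow_le_one₀ hε.le hε1
    have h5 : 0 < ε ^ 3 := by positivity
    rw [le_div_iff₀ h5]
    nlinarith
  · set n := ⌈(C / ε) ^ 3⌉₊
    have h1 : (C / ε) ^ 3 ≤ (n : ℝ) + 1 := (Nat.le_ceil _).trans (lt_add_one _).le
    have hT : (0 : ℝ) < (n : ℝ) + 1 := by positivity
    have hq3 := mul_rpow_neg_third_pow_three hT
    have hq0 : 0 < ((n : ℝ) + 1) ^ (-(1 / 3) : ℝ) := by positivity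
    set q := ((n : ℝ) + 1) ^ (-(1 / 3) : ℝ)
    have h2 : (C / ε * q) ^ 3 ≤ 1 := by
      rw [mul_pow, ← hq3]
      gcongr
    have h3 : C / ε * q ≤ 1 := (pow_le_one_iff_of_nonneg (by positivity) three_ne_zero).1 h2
    have h4 : C * q = ε * (C / ε * q) := by field_simp
    rw [h4]
    exact mul_le_of_le_one_right hε.le h3

theorem cubicComplexity_of_bound {bound : ℕ → ℝ} {C : ℝ}
    (h : ∀ K : ℕ, S.ExpGradNormLE (bvSchedule η₀ K) (bvSchedule γ₀ K) K (bound K))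
    (hb : ∀ K : ℕ, bound K ≤ C * ((K : ℝ) + 1) ^ (-(1 / 3) : ℝ)) :
    S.CubicComplexity η₀ γ₀ (complexityConstant C) (complexityHorizon C) :=
  -- Truncation at 0 is needed because `C` carries no sign assumption.
  cubicComplexity_of_rate (le_max_right _ _) fun K => (h K).mono ((hb K).trans
    (mul_le_mul_of_nonneg_right (le_max_left _ _) (by positivity)))

/-- The bound under mean-square smoothness. -/
theorem MeanSquareSmooth.expGradNormLE {L : ℝ} (hS : S.MeanSquareSmooth L) (hlow : S.LowerBounded)
    (h : S.BG0Oracle 0 G) (hL : 0 < L) (hη0 : 0 < η₀) (hη1 : η₀ ≤ 1) (hγ : 0 < γ₀) (K : ℕ) :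
    S.ExpGradNormLE (bvSchedule η₀ K) (bvSchedule γ₀ K) K
      (bvBoundMSS S.gap S.initError G L η₀ γ₀ ((K : ℝ) + 1)) := by
  have hT : (0 : ℝ) < (K : ℝ) + 1 := by positivity
  have hγe := bvSchedule_eq γ₀ K
  have hγpos : 0 < bvSchedule γ₀ K := by rw [hγe]; positivity
  have hd : S.AffineDrift (bvSchedule γ₀ K) (L * bvSchedule γ₀ K) 0 := by
    intro x y hxy
    refine (hS x y).2.trans ?_
    rw [zero_mul, add_zero, ← mul_pow]
    gcongr
  have hlip : ∀ x y, ‖gradient S.f y - gradient S.f x‖ ≤ L * ‖y - x‖ := fun x y =>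
    h.norm_gradient_sub_le (by positivity) ((hS x y).2.trans_eq (mul_pow _ _ _).symm)
  have hdesc : ∀ x y, ‖y - x‖ ≤ bvSchedule γ₀ K → S.f y ≤ S.f x + ⟪gradient S.f x, y - x⟫
      + bvSchedule γ₀ K * (L * bvSchedule γ₀ K / 2 + 0 * ‖gradient S.f x‖) := by
    intro x y hxy
    have h1 := le_add_inner_gradient_add_of_lipschitz S.differentiable_f hlip x y
    have h2 : L / 2 * ‖y - x‖ ^ 2 ≤ L / 2 * bvSchedule γ₀ K ^ 2 := by gcongr
    linarith
  refine (hd.expGradNormLE (c := 1) hlow h hη0 hη1 hγ (by positivity) le_rfl hdesc zero_le_one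
    (by simp)).mono (le_of_eq ?_)
  rw [bvBoundMSS, rpow_neg_two_thirds hT.le, hγe]
  have hq0 : 0 < ((K : ℝ) + 1) ^ (-(1 / 3) : ℝ) := by positivity
  have hs : 0 < √η₀ := Real.sqrt_pos.2 hη0
  field_simp
  ring

/-- The rate of a run whose drift has a small slope in the gradient norm. -/
theorem AffineDrift.expGradNormLE_of_slope_le {K : ℕ}
    (hd : S.AffineDrift (bvSchedule γ₀ K) A B) (hlow : S.LowerBounded) (h : S.BG0Oracle 0 G)
    (hη0 : 0 < η₀) (hη1 : η₀ ≤ 1) (hγ : 0 < γ₀) (hA : 0 < A) (hB : 0 ≤ B)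
    (hBη : 8 * B ≤ bvSchedule η₀ K) :
    S.ExpGradNormLE (bvSchedule η₀ K) (bvSchedule γ₀ K) K
      ((4 * S.gap / γ₀ + 8 * S.initError / η₀ + 8 * √η₀ * G) * ((K : ℝ) + 1) ^ (-(1 / 3) : ℝ)
        + 4 * (A / (√η₀ * ((K : ℝ) + 1) ^ (-(1 / 3) : ℝ))) + 2 * A) := by
  have hq0 : 0 < ((K : ℝ) + 1) ^ (-(1 / 3) : ℝ) := by positivity
  have hq1 := rpow_neg_third_le_one (T := (K : ℝ) + 1) (by simp)
  have hη := bvSchedule_eq η₀ K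
  have hηpos : 0 < bvSchedule η₀ K := by rw [hη]; positivity
  have hηle : bvSchedule η₀ K ≤ 1 := by
    rw [hη]; exact mul_le_one₀ hη1 (sq_nonneg _) (pow_le_one₀ hq0.le hq1)
  have h1 : B / bvSchedule η₀ K ≤ 1 / 8 := by rw [div_le_iff₀ hηpos]; linarith
  -- With `8B ≤ η ≤ 1` the factor `1 - 2B/η - B` is at least `5/8`, so `c = 2` suffices.
  refine (hd.expGradNormLE (c := 2) hlow h hη0 hη1 hγ hA hB
    (fun x y hxy => hd.descent h hA.le hB x y hxy) zero_le_two (by linarith)).mono ?_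
  have h2 : 0 ≤ S.gap / γ₀ := div_nonneg (gap_nonneg hlow) hγ.le
  have h3 : 0 ≤ S.initError / η₀ := div_nonneg h.initError_le.2.1 hη0.le
  have h4 : 0 ≤ √η₀ * G := mul_nonneg (Real.sqrt_nonneg _) h.2.1
  have h5 : 2 * (S.gap / γ₀ + 2 * (S.initError / η₀) + 2 * (√η₀ * G))
      ≤ 4 * S.gap / γ₀ + 8 * S.initError / η₀ + 8 * √η₀ * G := by
    rw [mul_div_assoc, mul_div_assoc]
    linarith
  have h6 := mul_le_mul_of_nonneg_right h5 hq0.le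
  linarith

/-- The bound under expected symmetric generalized smoothness with exponent in `(0, 1)`. -/
theorem ExpectedSymSmooth.expGradNormLE_of_lt_one {α L₀ L₁ lam₀ : ℝ}
    (hS : S.ExpectedSymSmooth α L₀ L₁) (hlow : S.LowerBounded) (h : S.BG0Oracle 0 G)
    (hα : 0 < α) (hα1 : α < 1) (hL₀ : 0 < L₀) (hL₁ : 0 < L₁) (hη0 : 0 < η₀) (hη1 : η₀ ≤ 1)
    (hγ : 0 < γ₀) (hl : 0 < lam₀) (hsmall : 8 * symLα α L₁ * lam₀ * (γ₀ / η₀) ≤ 1) (K : ℕ) :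
    S.ExpGradNormLE (bvSchedule η₀ K) (bvSchedule γ₀ K) K
      (bvBoundAlpha α S.gap S.initError G L₀ L₁ η₀ γ₀ lam₀ ((K : ℝ) + 1)) := by
  have hT : (0 : ℝ) < (K : ℝ) + 1 := by positivity
  have hq0 : 0 < ((K : ℝ) + 1) ^ (-(1 / 3) : ℝ) := by positivity
  have hγe := bvSchedule_eq γ₀ K
  have hγpos : 0 < bvSchedule γ₀ K := by rw [hγe]; positivity
  have hK₀ := symK₀_pos (α := α) hL₀
  have hK₂ := symK₂_pos (α := α) hL₁
  have hLα := symLα_pos (α := α) hL₁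
  have hc := symc_nonneg hα hα1
  have hG := h.2.1
  have hGα : 0 ≤ G ^ α := by positivity
  set A := bvSchedule γ₀ K * (symK₀ α L₀ + symc α * symLα α L₁ * lam₀ ^ (-symp α)
    + symLα α L₁ * G ^ α) + symK₂ α L₁ * bvSchedule γ₀ K ^ (symp α + 1) with hA
  have hd : S.AffineDrift (bvSchedule γ₀ K) A (bvSchedule γ₀ K * symLα α L₁ * lam₀) := by
    intro x y hxy
    obtain ⟨h1, h2⟩ := growth_lt_of_lt_one hα hα1 hL₀ hL₁ hG (norm_nonneg (gradient S.f x)) hγpos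
      hl rfl
    exact hS.integral_norm_sub_sq_le h hα hα1.le hL₀ hL₁ hγpos hxy h1 h2
  have hApos : 0 < A := by positivity
  have hBη : 8 * (bvSchedule γ₀ K * symLα α L₁ * lam₀) ≤ bvSchedule η₀ K := by
    have h1 : 8 * symLα α L₁ * lam₀ * γ₀ ≤ η₀ := by
      rwa [← mul_div_assoc, div_le_one hη0] at hsmall
    rw [bvSchedule_eq, bvSchedule_eq]
    have := mul_le_mul_of_nonneg_right h1 (sq_nonneg (((K : ℝ) + 1) ^ (-(1 / 3) : ℝ)))
    linarith
  refine (hd.expGradNormLE_of_slope_le hlow h hη0 hη1 hγ hApos (by positivity) hBη).mono ?_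
  have hpow : bvSchedule γ₀ K ^ (symp α + 1)
      = γ₀ ^ (symp α + 1) * ((K : ℝ) + 1) ^ (-(2 * (symp α + 1) / 3)) := by
    rw [bvSchedule, Real.mul_rpow hγ.le (by positivity), ← Real.rpow_mul hT.le]
    congr 2
    ring
  -- Dividing the `symK₂` part of `A` by `√η` costs one factor `T^(-1/3)`, which explains the
  -- exponent `(1 + 2p)/3`.
  have hpow2 : ((K : ℝ) + 1) ^ (-(2 * (symp α + 1) / 3))
      = ((K : ℝ) + 1) ^ (-((1 + 2 * symp α) / 3)) * ((K : ℝ) + 1) ^ (-(1 / 3) : ℝ) := by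
    rw [← Real.rpow_add hT]
    congr 1
    ring
  have hs : 0 < √η₀ := Real.sqrt_pos.2 hη0
  set E := symK₀ α L₀ + symc α * symLα α L₁ * lam₀ ^ (-symp α) with hE
  have hE0 : 0 ≤ E := by positivity
  have hAdiv : A / (√η₀ * ((K : ℝ) + 1) ^ (-(1 / 3) : ℝ))
      = γ₀ / √η₀ * (E + symLα α L₁ * G ^ α) * ((K : ℝ) + 1) ^ (-(1 / 3) : ℝ)
        + symK₂ α L₁ * γ₀ ^ (symp α + 1) / √η₀ * ((K : ℝ) + 1) ^ (-((1 + 2 * symp α) / 3)) := by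
    rw [hA, hpow, hpow2, hγe]
    field_simp
  have hAeq : A = (γ₀ * E + symLα α L₁ * G ^ α * γ₀) * ((K : ℝ) + 1) ^ (-(2 / 3) : ℝ)
      + symK₂ α L₁ * γ₀ ^ (symp α + 1) * ((K : ℝ) + 1) ^ (-(2 * (symp α + 1) / 3)) := by
    rw [hA, hpow, bvSchedule]
    ring
  rw [hAdiv, hAeq, bvBoundAlpha, ← hE]
  have h1 : 0 ≤ γ₀ / √η₀ * (E + symLα α L₁ * G ^ α) * ((K : ℝ) + 1) ^ (-(1 / 3) : ℝ) := by
    positivity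
  have h2 : 0 ≤ symK₂ α L₁ * γ₀ ^ (symp α + 1) / √η₀
      * ((K : ℝ) + 1) ^ (-((1 + 2 * symp α) / 3)) := by positivity
  have h3 : 0 ≤ symK₂ α L₁ * γ₀ ^ (symp α + 1)
      * ((K : ℝ) + 1) ^ (-(2 * (symp α + 1) / 3)) := by positivity
  linear_combination 4 * h1 + 4 * h2 + 2 * h3

/-- The bound under expected symmetric generalized smoothness with exponent `1`. -/
theorem ExpectedSymSmooth.expGradNormLE_of_one {L₀ L₁ : ℝ}
    (hS : S.ExpectedSymSmooth 1 L₀ L₁) (hlow : S.LowerBounded) (h : S.BG0Oracle 0 G)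
    (hL₀ : 0 < L₀) (hL₁ : 0 < L₁) (hη0 : 0 < η₀) (hη1 : η₀ ≤ 1)
    (hγ : 0 < γ₀) (hγ1 : γ₀ ≤ 1 / (4 * √2 * L₁))
    (hsmall : 16 * √(2 * Real.exp (3 / 4)) * L₁ * (γ₀ / η₀) ≤ 1) (K : ℕ) :
    S.ExpGradNormLE (bvSchedule η₀ K) (bvSchedule γ₀ K) K
      (bvBoundOne S.gap S.initError G L₀ L₁ η₀ γ₀ ((K : ℝ) + 1)) := by
  have hT : (0 : ℝ) < (K : ℝ) + 1 := by positivity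
  have hq0 : 0 < ((K : ℝ) + 1) ^ (-(1 / 3) : ℝ) := by positivity
  have hq1 := rpow_neg_third_le_one (T := (K : ℝ) + 1) (by simp)
  have hγe := bvSchedule_eq γ₀ K
  have hγpos : 0 < bvSchedule γ₀ K := by rw [hγe]; positivity
  have hγle : bvSchedule γ₀ K ≤ γ₀ := by
    rw [hγe]; exact mul_le_of_le_one_right hγ.le (pow_le_one₀ hq0.le hq1)
  have hG := h.2.1
  have hs2 : √2 ≤ √(2 * Real.exp (3 / 4)) :=
    Real.sqrt_le_sqrt (le_mul_of_one_le_right zero_le_two (Real.one_le_exp (by norm_num)))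
  have hγ2 : bvSchedule γ₀ K * (4 * √2 * L₁) ≤ 1 := by
    rw [le_div_iff₀ (by positivity)] at hγ1
    exact (mul_le_mul_of_nonneg_right hγle (by positivity)).trans hγ1
  have hd : S.AffineDrift (bvSchedule γ₀ K) (√2 * bvSchedule γ₀ K * (L₀ + 2 * L₁ * G))
      (2 * √2 * bvSchedule γ₀ K * L₁) := by
    intro x y hxy
    obtain ⟨h1, h2⟩ := growth_lt_of_one hL₀ hL₁ hG (norm_nonneg (gradient S.f x)) hγpos hγ2 rfl
    exact hS.integral_norm_sub_sq_le h one_pos le_rfl hL₀ hL₁ hγpos hxy h1 h2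
  have hBη : 8 * (2 * √2 * bvSchedule γ₀ K * L₁) ≤ bvSchedule η₀ K := by
    have h1 : 16 * √(2 * Real.exp (3 / 4)) * L₁ * γ₀ ≤ η₀ := by
      rwa [← mul_div_assoc, div_le_one hη0] at hsmall
    -- The barrier argument needs only `√2`; the larger constant with the exponential enters through
    -- monotonicity alone.
    have h2 : 16 * √2 * L₁ * γ₀ ≤ η₀ := le_trans (by gcongr) h1
    rw [bvSchedule_eq, bvSchedule_eq]
    have := mul_le_mul_of_nonneg_right h2 (sq_nonneg (((K : ℝ) + 1) ^ (-(1 / 3) : ℝ)))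
    linarith
  refine (hd.expGradNormLE_of_slope_le hlow h hη0 hη1 hγ (by positivity) (by positivity)
    hBη).mono ?_
  have hs : 0 < √η₀ := Real.sqrt_pos.2 hη0
  rw [bvBoundOne, rpow_neg_two_thirds hT.le, hγe]
  set q := ((K : ℝ) + 1) ^ (-(1 / 3) : ℝ)
  have hAdiv : √2 * (γ₀ * q ^ 2) * (L₀ + 2 * L₁ * G) / (√η₀ * q)
      = √2 * γ₀ / √η₀ * (L₀ + 2 * L₁ * G) * q := by
    field_simp
  rw [hAdiv]
  have h1 : √2 * γ₀ / √η₀ * (L₀ + 2 * L₁ * G) * q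
      ≤ √(2 * Real.exp (3 / 4)) * γ₀ / √η₀ * (L₀ + 2 * L₁ * G) * q := by gcongr
  have h2 : 0 ≤ √(2 * Real.exp (3 / 4)) * γ₀ / √η₀ * (L₀ + 2 * L₁ * G) * q := by positivity
  have h3 : 0 ≤ √2 * (γ₀ * q ^ 2) * (L₀ + 2 * L₁ * G) := by positivity
  linear_combination 4 * h1 + 4 * h2 + 2 * h3

end StochasticSetup

theorem mainTheorem4 :
    -- (i) mean-square smoothness
    (∀ Δ₀ G L η₀ γ₀ : ℝ, 0 < L → 0 < η₀ → η₀ ≤ 1 → 0 < γ₀ →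
      ∃ (C : ℝ) (N : ℝ → ℕ), ∀ (d : ℕ) (Ω : Type*) (Ξ : Type*)
        [MeasurableSpace Ω] [MeasurableSpace Ξ] (S : StochasticSetup d Ω Ξ),
        S.LowerBounded → S.gap ≤ Δ₀ → S.BG0Oracle 0 G → S.MeanSquareSmooth L →
        S.initError ≤ G ∧
        (∀ K : ℕ, S.ExpGradNormLE (bvSchedule η₀ K) (bvSchedule γ₀ K) K
          (bvBoundMSS S.gap S.initError G L η₀ γ₀ ((K : ℝ) + 1))) ∧
        S.CubicComplexity η₀ γ₀ C N) ∧
    -- (ii) expected symmetric generalized smoothness with exponent in (0,1)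
    (∀ α Δ₀ G L₀ L₁ η₀ γ₀ lam₀ : ℝ, 0 < α → α < 1 → 0 < L₀ → 0 < L₁ →
      0 < η₀ → η₀ ≤ 1 → 0 < γ₀ → 0 < lam₀ →
      symLα α L₁ * lam₀ * γ₀ ≤ 1 → 8 * symLα α L₁ * lam₀ * (γ₀ / η₀) ≤ 1 →
      ∃ (C : ℝ) (N : ℝ → ℕ), ∀ (d : ℕ) (Ω : Type*) (Ξ : Type*)
        [MeasurableSpace Ω] [MeasurableSpace Ξ] (S : StochasticSetup d Ω Ξ),
        S.LowerBounded → S.gap ≤ Δ₀ → S.BG0Oracle 0 G → S.ExpectedSymSmooth α L₀ L₁ →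
        S.initError ≤ G ∧
        (∀ K : ℕ, S.ExpGradNormLE (bvSchedule η₀ K) (bvSchedule γ₀ K) K
          (bvBoundAlpha α S.gap S.initError G L₀ L₁ η₀ γ₀ lam₀ ((K : ℝ) + 1))) ∧
        S.CubicComplexity η₀ γ₀ C N) ∧
    -- (iii) expected symmetric generalized smoothness with exponent 1
    (∀ Δ₀ G L₀ L₁ η₀ γ₀ : ℝ, 0 < L₀ → 0 < L₁ →
      0 < η₀ → η₀ ≤ 1 → 0 < γ₀ →
      γ₀ ≤ 1 / (4 * √2 * L₁) → 16 * √(2 * Real.exp (3 / 4)) * L₁ * (γ₀ / η₀) ≤ 1 →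
      ∃ (C : ℝ) (N : ℝ → ℕ), ∀ (d : ℕ) (Ω : Type*) (Ξ : Type*)
        [MeasurableSpace Ω] [MeasurableSpace Ξ] (S : StochasticSetup d Ω Ξ),
        S.LowerBounded → S.gap ≤ Δ₀ → S.BG0Oracle 0 G → S.ExpectedSymSmooth 1 L₀ L₁ →
        S.initError ≤ G ∧
        (∀ K : ℕ, S.ExpGradNormLE (bvSchedule η₀ K) (bvSchedule γ₀ K) K
          (bvBoundOne S.gap S.initError G L₀ L₁ η₀ γ₀ ((K : ℝ) + 1))) ∧
        S.CubicComplexity η₀ γ₀ C N) := by 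
  refine ⟨?_, ?_, ?_⟩
  · intro Δ₀ G L η₀ γ₀ hL hη0 hη1 hγ
    -- The witnesses precede the choice of problem, so they use only the parameters, with `G` in
    -- place of the initial error.
    refine ⟨complexityConstant (bvBoundMSS Δ₀ G G L η₀ γ₀ 1),
      complexityHorizon (bvBoundMSS Δ₀ G G L η₀ γ₀ 1), fun d Ω Ξ _ _ S hlow hgap h hS => ?_⟩
    have hb := h.initError_le.2.2
    have hK := fun K => hS.expGradNormLE hlow h hL hη0 hη1 hγ K
    exact ⟨hb, hK, StochasticSetup.cubicComplexity_of_bound hK fun K =>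
      bvBoundMSS_le hL.le hη0 hγ hgap hb (by simp)⟩
  · intro α Δ₀ G L₀ L₁ η₀ γ₀ lam₀ hα hα1 hL₀ hL₁ hη0 hη1 hγ hl _ hsmall
    refine ⟨complexityConstant (bvBoundAlpha α Δ₀ G G L₀ L₁ η₀ γ₀ lam₀ 1),
      complexityHorizon (bvBoundAlpha α Δ₀ G G L₀ L₁ η₀ γ₀ lam₀ 1), fun d Ω Ξ _ _ S hlow hgap h hS => ?_⟩
    have hb := h.initError_le.2.2
    have hK := fun K =>
      hS.expGradNormLE_of_lt_one hlow h hα hα1 hL₀ hL₁ hη0 hη1 hγ hl hsmall K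
    exact ⟨hb, hK, StochasticSetup.cubicComplexity_of_bound hK fun K =>
      bvBoundAlpha_le hα hα1 hL₀ hL₁ hη0 hγ hl h.2.1 hgap hb (by simp)⟩
  · intro Δ₀ G L₀ L₁ η₀ γ₀ hL₀ hL₁ hη0 hη1 hγ hγ1 hsmall
    refine ⟨complexityConstant (bvBoundOne Δ₀ G G L₀ L₁ η₀ γ₀ 1),
      complexityHorizon (bvBoundOne Δ₀ G G L₀ L₁ η₀ γ₀ 1), fun d Ω Ξ _ _ S hlow hgap h hS => ?_⟩
    have hb := h.initError_le.2.2
    have hK := fun K => hS.expGradNormLE_of_one hlow h hL₀ hL₁ hη0 hη1 hγ hγ1 hsmall K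
    exact ⟨hb, hK, StochasticSetup.cubicComplexity_of_bound hK fun K =>
      bvBoundOne_le hL₀ hL₁ hη0 hγ h.2.1 hgap hb (by simp)⟩
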